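/- For $X\subset\mathbb R^n$ let $c(X)=\{(hx,h)\mid x\in X,\ h\ge 0\}\subset\mathbb R^n\times\mathbb R$ be its cone, with the induced metric, and let $c_L(X)$ be the part of $c(X)$ with $h\ge L$. A map $f\colon A\to B$ of metric spaces is *coarse* if for every $R>0$ there is $S>0$ with $d(f(x),f(y))<S$ whenever $d(x,y)<R$, and if preimages of bounded sets are bounded. For a coarse map $p\colon A\to\mathbb R_+=[0,\infty)$ put $I_pA=\{(a,t)\in A\times\mathbb R_+\mid t\le p(a)+1\}$. A *coarse homotopy* from $f$ to $g$, where $f,g\colon A\to B$, is a coarse map $H\colon I_pA\to B$, for some coarse $p$, with $H(a,0)=f(a)$ and $H(a,p(a)+1)=g(a)$; it is a homotopy of maps of pairs $(A,A_0)\to(B,B_0)$ if $H(a,t)\in B_0$ for all $a\in A_0$. The *inverse* of $K\colon I_qA\to B$ is $(a,t)\mapsto K(a,q(a)+1-t)$, and the *concatenation* of $K\colon I_qA\to B$ with $K'\colon I_{q'}A\to B$ is the map on $I_{q+q'+1}A$ given by $K(a,t)$ for $t\le q(a)+1$ and by $K'(a,t-q(a)-1)$ afterwards. A map $g$ between (parts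 of) cones is *radial* if $g(rz)=r\,g(z)$ whenever $r\ge 0$ and $z$, $rz$ lie in its domain; it is *induced by* a map $u$ of the bases if $g(hx,h)=(h\,u(x),h)$. **Proposition.** Let $X$ and $Y$ be finite simplicial complexes PL-embedded into $\mathbb R^n$, with subcomplexes $X_0\subset X$ and $Y_0\subset Y$, and let $f\colon(c(X),c(X_0))\to(c(Y),c(Y_0))$ be a coarse map of pairs (that is, $f$ is coarse and $f(c(X_0))\subset c(Y_0)$). 1. There are $L>0$ and a radial proper Lipschitz map $g\colon c_L(X)\to c(Y)$, which can moreover be taken to be induced by a map $u\colon X\to Y$, such that $f|_{c_L(X)}$ is coarsely homotopic to $g$ as a map of pairs $(c_L(X),c_L(X_0))\to(c(Y),c(Y_0))$. 2. Let $X_1\subset X$ be a subcomplex such that $f|_{c(X_1)}$ is radial and Lipschitz. Then there are $L>0$, a radial proper Lipschitz map $g\colon c_L(X)\to c(Y)$ with $g|_{c_L(X_1)}=f|_{c_L(X_1)}$, and a coarse homotopy of pairs $H$ from $f|_{c_L(X)}$ to $g$ such that the restriction of $H$ to $c_L(X_1)$ is the concatenation of a coarse homotopy of the form $$(hx,h,t)\mapsto\rho(h,t)\,f(Lx,L),\qquad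 x\in X_1,\ h\ge L,\ 0\le t\le h,$$ for a real-valued function $\rho$, with its inverse. If $f|_{c(X_1)}$ is induced by a map $X_1\to Y$, then $g$ can in addition be taken to be induced by a map $X\to Y$. -/

import Mathlib

open scoped NNReal

noncomputable section

/-! ### Coarse maps between metric spaces (with their bounded coarse structures) -/

/-- A map between metric spaces is coarse if it is controlled and preimages of bounded sets are
bounded. -/
def IsCoarse {A B : Type*} [PseudoMetricSpace A] [PseudoMetricSpace B] (f : A → B) : Prop :=
  (∀ R : ℝ, 0 < R → ∃ S : ℝ, 0 < S ∧ ∀ x y : A, dist x y < R → dist (f x) (f y) < S) ∧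
  ∀ D : Set B, Bornology.IsBounded D → Bornology.IsBounded (f ⁻¹' D)

/-- A coarse map of pairs `(A, A₀) → (B, B₀)`, where `A₀` and `B₀` are subspaces. (The restriction
`A₀ → B₀` is then automatically coarse.) -/
def IsCoarsePairMap {A B : Type*} [PseudoMetricSpace A] [PseudoMetricSpace B]
    (f : A → B) (A₀ : Set A) (B₀ : Set B) : Prop :=
  IsCoarse f ∧ Set.MapsTo f A₀ B₀

/-! ### Coarse homotopy -/

/-- The `p`-cylinder `I_p A = {(a, t) ∈ A × ℝ₊ | t ≤ p a + 1}`. The metric on `A × ℝ₊` is the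
maximum metric, whose bounded coarse structure is the product coarse structure. -/
def Cyl {A : Type*} (p : A → ℝ≥0) : Set (A × ℝ≥0) :=
  {z | z.2 ≤ p z.1 + 1}

/-- The start inclusion `a ↦ (a, 0)`. -/
def Cyl.bot {A : Type*} (p : A → ℝ≥0) (a : A) : Cyl p :=
  ⟨(a, 0), by simp [Cyl]⟩

/-- The end inclusion `a ↦ (a, p a + 1)`. -/
def Cyl.top {A : Type*} (p : A → ℝ≥0) (a : A) : Cyl p :=
  ⟨(a, p a + 1), le_refl (p a + 1)⟩

/-- `H : I_p A → B` is a coarse homotopy from `f` to `g` of maps of pairs `(A, A₀) → (B, B₀)`. -/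
def IsCoarsePairHomotopy {A B : Type*} [PseudoMetricSpace A] [PseudoMetricSpace B]
    (p : A → ℝ≥0) (H : Cyl p → B) (f g : A → B) (A₀ : Set A) (B₀ : Set B) : Prop :=
  IsCoarse p ∧ IsCoarse H ∧ (∀ a, H (Cyl.bot p a) = f a) ∧ (∀ a, H (Cyl.top p a) = g a) ∧
  ∀ z : Cyl p, z.1.1 ∈ A₀ → H z ∈ B₀

/-- Two maps are coarsely homotopic as maps of pairs `(A, A₀) → (B, B₀)`. -/
def CoarselyHomotopicPair {A B : Type*} [PseudoMetricSpace A] [PseudoMetricSpace B]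
    (f g : A → B) (A₀ : Set A) (B₀ : Set B) : Prop :=
  ∃ (p : A → ℝ≥0) (H : Cyl p → B), IsCoarsePairHomotopy p H f g A₀ B₀

/-- The inverse homotopy `(a, t) ↦ K (a, q a + 1 - t)`. -/
def homotopyInverse {A B : Type*} {q : A → ℝ≥0} (K : Cyl q → B) : Cyl q → B :=
  fun z => K ⟨(z.1.1, q z.1.1 + 1 - z.1.2), by simp [Cyl]⟩

/-- The concatenation of `K : I_q A → B` and `K' : I_q' A → B`, defined on `I_{q + q' + 1} A`:
it is `K (a, t)` for `t ≤ q a + 1` and `K' (a, t - (q a + 1))` afterwards. -/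
def homotopyConcat {A B : Type*} {q q' : A → ℝ≥0} (K : Cyl q → B) (K' : Cyl q' → B) :
    Cyl (fun a => q a + q' a + 1) → B :=
  fun z =>
    if h : z.1.2 ≤ q z.1.1 + 1 then K ⟨z.1, h⟩
    else K' ⟨(z.1.1, z.1.2 - (q z.1.1 + 1)), by
      have hz : z.1.2 ≤ q z.1.1 + q' z.1.1 + 1 + 1 := z.2
      refine tsub_le_iff_left.2 (hz.trans (le_of_eq ?_))
      ring⟩

/-! ### Metric cones with flat base -/

/-- The cone `c(X) = {(h x, h) | h ≥ 0, x ∈ X} ⊆ E × ℝ`. The product `E × ℝ` carries the maximum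
metric, which is bilipschitz equivalent to the Hilbert space metric; all notions used below
(Lipschitz, proper, coarse) depend only on the bilipschitz class. -/
def cone {E : Type*} [AddCommGroup E] [Module ℝ E] (X : Set E) : Set (E × ℝ) :=
  {z | ∃ x ∈ X, ∃ h : ℝ, 0 ≤ h ∧ z = (h • x, h)}

/-- The part `c_L(X)` of the cone of height at least `L`. -/
def coneAbove {E : Type*} [AddCommGroup E] [Module ℝ E] (L : ℝ) (X : Set E) : Set (E × ℝ) :=
  {z ∈ cone X | L ≤ z.2}

/-- The point `(h x, h)` of `c(X)`. -/
def conePoint {E : Type*} [AddCommGroup E] [Module ℝ E] {X : Set E} (x : X) (h : ℝ) (hh : 0 ≤ h) :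
    cone X :=
  ⟨(h • (x : E), h), x, x.2, h, hh, rfl⟩

/-- The restriction to `c_L(X)` of a map defined on `c(X)`. -/
def restrictAbove {E B : Type*} [AddCommGroup E] [Module ℝ E] {X : Set E} (L : ℝ)
    (f : cone X → B) : coneAbove L X → B :=
  fun z => f ⟨z.1, z.2.1⟩

/-- `A ∩ S` as a subset of the subspace `A`. -/
def traceOn {V : Type*} (A S : Set V) : Set A :=
  {z | (z : V) ∈ S}

/-- `f : A → B` is radial on `S`: `f (r z) = r f (z)` whenever `z` and `r z` lie in `S`, `r ≥ 0`. -/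
def IsRadialOn {V W : Type*} [AddCommGroup V] [Module ℝ V] [AddCommGroup W] [Module ℝ W]
    {A : Set V} {B : Set W} (f : A → B) (S : Set V) : Prop :=
  ∀ z w : A, (z : V) ∈ S → (w : V) ∈ S → ∀ r : ℝ, 0 ≤ r →
    (w : V) = r • (z : V) → (f w : W) = r • (f z : W)

/-- On the points of `A` lying over `X`, the map `f` is the radial map `c(u)` induced by a map
`u : X → Y`, that is, `f (h x, h) = (h u(x), h)`. -/
def IsInducedOn {E F : Type*} [AddCommGroup E] [Module ℝ E] [AddCommGroup F] [Module ℝ F]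
    {A : Set (E × ℝ)} {B : Set (F × ℝ)} (f : A → B) (X : Set E) (Y : Set F) : Prop :=
  ∃ u : X → Y, ∀ (z : A) (x : X) (h : ℝ), 0 ≤ h → (z : E × ℝ) = (h • (x : E), h) →
    (f z : F × ℝ) = (h • (u x : F), h)

/-! ### PL-embedded finite simplicial complexes -/

/-- `i` restricts to a PL-embedding of the polyhedron of the (geometrically realized) simplicial
complex `K`: it is injective there, and affine on each simplex of some finite subdivision of `K`. -/
def IsPLEmbedding {V E : Type*} [AddCommGroup V] [Module ℝ V] [AddCommGroup E] [Module ℝ E]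
    (K : Geometry.SimplicialComplex ℝ V) (i : V → E) : Prop :=
  Set.InjOn i K.space ∧
  ∃ K' : Geometry.SimplicialComplex ℝ V, K'.faces.Finite ∧ K'.space = K.space ∧
    (∀ s ∈ K'.faces, ∃ t ∈ K.faces,
      convexHull ℝ (s : Set V) ⊆ convexHull ℝ (t : Set V)) ∧
    ∀ s ∈ K'.faces, ∃ a : V →ᵃ[ℝ] E, Set.EqOn i a (convexHull ℝ (s : Set V))

end

/-!
Coarse maps between cones over PL-embedded finite complexes are coarsely homotopic to radial maps.

**Coordinates.** Barycentric coordinates identify the cone over an embedded complex, linearly and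
simultaneously for all subcomplexes, with an `orthantComplex`: the set of nonnegative vectors
`c : V → ℝ` whose support is a simplex (`IsPLEmbedding.exists_coneCoord`). The coordinate map is
bi-Lipschitz by a compactness argument (`exists_norm_sub_le_of_injOn_orthantComplex`). In an orthant
complex the metric facts needed are explicit. Subtracting the least possible constant from all
coordinates and taking positive parts is a Lipschitz retraction of `V → ℝ`
(`exists_lipschitz_retraction_orthantComplex`); and two points `a`, `b` are joined by the broken
line through `a ⊓ b`, of length comparable to their distance, whose middle vertex lies in every
subcomplex containing `a` or `b` (`IsPLEmbedding.exists_broken_line`).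

**Lipschitz approximation.** Broken lines show that a coarse map `f` is large-scale Lipschitz, hence
Lipschitz on separated nets. Extending from a net and retracting onto the target cone gives a
Lipschitz map at bounded distance from `f`. This is done first on the cone over `X₀`, with values in
the cone over `Y₀`, and then on the whole cone, keeping the values on the cone over `X₁`
(`IsCoarsePairMap.exists_lipschitz_approximation`). If `f` is induced on `X₁`, the approximation `F`
is rescaled near the level `L` to preserve the height there (`exists_height_normalization`).

**Homotopy.** Over a point `(h x, h)`, the homotopy first moves down to `F (y x, y)` with
`y = √(L h)`, at unit speed, and then is `(s² / (L h)) F (y x, y)` with `s` growing from `√(L h)` to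
`h`, and `y = L h / s`. It ends at the radial map `(h / L) F (L x, L)`. A direct contraction to
level `L` would need time of order `h log h`, which is not allowed in a coarse homotopy; stopping at
the geometric mean of `L` and `h` makes the homotopy Lipschitz (`exists_dist_radialHomotopy_le`).
Where `F` is radial, the second phase traverses the first one backwards
(`radialHomotopy_of_radial`).
-/

/-! ### Orthant complexes -/

/-- The cone over the simplicial complex with vertex set `V` and faces `S`, in barycentric
coordinates: the nonnegative vectors whose support lies in a face. The last coordinate of the
geometric cone corresponds to the sum of the coordinates. -/
def orthantComplex {V : Type*} (S : Set (Set V)) : Set (V → ℝ) :=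
  {c | 0 ≤ c ∧ ∃ s ∈ S, ∀ v ∉ s, c v = 0}

section OrthantComplex

variable {V : Type*} {S S' : Set (Set V)}

theorem orthantComplex_mono (h : S ⊆ S') : orthantComplex S ⊆ orthantComplex S' :=
  fun _ hc => ⟨hc.1, hc.2.imp fun _ hs => ⟨h hs.1, hs.2⟩⟩

theorem mem_orthantComplex_of_le {a b : V → ℝ} (ha : 0 ≤ a) (hab : a ≤ b)
    (hb : b ∈ orthantComplex S) : a ∈ orthantComplex S := by
  obtain ⟨-, s, hs, h⟩ := hb
  exact ⟨ha, s, hs, fun v hv => le_antisymm ((hab v).trans (h v hv).le) (ha v)⟩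

theorem smul_mem_orthantComplex {a : V → ℝ} (ha : a ∈ orthantComplex S) {r : ℝ} (hr : 0 ≤ r) :
    r • a ∈ orthantComplex S := by
  obtain ⟨h0, s, hs, h⟩ := ha
  exact ⟨smul_nonneg hr h0, s, hs, fun v hv => by simp [h v hv]⟩

theorem zero_mem_orthantComplex (hS : S.Nonempty) : (0 : V → ℝ) ∈ orthantComplex S :=
  ⟨le_rfl, hS.some, hS.some_mem, fun _ _ => rfl⟩

theorem segment_subset_orthantComplex {a b : V → ℝ} (ha : 0 ≤ a) (hab : a ≤ b)
    (hb : b ∈ orthantComplex S) : segment ℝ b a ⊆ orthantComplex S := by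
  rintro _ ⟨p, q, hp, hq, hpq, rfl⟩
  refine mem_orthantComplex_of_le (add_nonneg (smul_nonneg hp hb.1) (smul_nonneg hq ha)) ?_ hb
  calc p • b + q • a ≤ p • b + q • b := by gcongr
    _ = b := by rw [← add_smul, hpq, one_smul]

theorem isClosed_orthantComplex [Finite V] : IsClosed (orthantComplex S) := by
  have : orthantComplex S = ⋃ s ∈ S, Set.Ici 0 ∩ ⋂ v, ⋂ (_ : v ∉ s), {c : V → ℝ | c v = 0} := by
    ext c
    simp only [orthantComplex, Set.mem_ofPred_eq, Set.mem_iUnion, Set.mem_inter_iff, Set.mem_Ici,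
      Set.mem_iInter]
    grind
  rw [this]
  refine Set.Finite.isClosed_biUnion (Set.toFinite S) fun s _ => isClosed_Ici.inter ?_
  exact isClosed_iInter fun v => isClosed_iInter fun _ =>
    isClosed_eq (continuous_apply v) continuous_const

/-- A linear map that is injective on an orthant complex is bi-Lipschitz on it: the positive and the
negative part of a difference of two points lie in the complex, and the unit vectors with
this property form a compact set on which the linear map does not vanish. -/
theorem exists_norm_sub_le_of_injOn_orthantComplex [Fintype V] {W : Type*} [NormedAddCommGroup W]
    [NormedSpace ℝ W] (Φ : (V → ℝ) →ₗ[ℝ] W) (hΦ : Set.InjOn Φ (orthantComplex S)) :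
    ∃ C : ℝ, 0 < C ∧ ∀ a ∈ orthantComplex S, ∀ b ∈ orthantComplex S,
      ‖a - b‖ ≤ C * ‖Φ a - Φ b‖ := by
  set D : Set (V → ℝ) := {c | c ⊔ 0 ∈ orthantComplex S ∧ (-c) ⊔ 0 ∈ orthantComplex S} with hD
  have hpos : Continuous fun c : V → ℝ => c ⊔ 0 :=
    continuous_pi fun v => (continuous_apply v).max continuous_const
  have hDclosed : IsClosed D := (isClosed_orthantComplex.preimage hpos).inter
    (isClosed_orthantComplex.preimage (hpos.comp continuous_neg))
  have hDne : ∀ c ∈ D, Φ c = 0 → c = 0 := by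
    intro c hc h0
    have hsub : c ⊔ 0 - (-c) ⊔ 0 = c := by
      ext v
      simp only [Pi.sub_apply, Pi.sup_apply, Pi.neg_apply, Pi.zero_apply]
      grind
    have : Φ (c ⊔ 0) = Φ ((-c) ⊔ 0) := by rw [← sub_eq_zero, ← map_sub, hsub, h0]
    have h := hΦ hc.1 hc.2 this
    rw [← hsub, h, sub_self]
  have hsub : ∀ a ∈ orthantComplex S, ∀ b ∈ orthantComplex S, a - b ∈ D := by
    intro a ha b hb
    refine ⟨mem_orthantComplex_of_le le_sup_right ?_ ha,
      mem_orthantComplex_of_le le_sup_right ?_ hb⟩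
    · exact sup_le (sub_le_self a hb.1) ha.1
    · exact sup_le (by rw [neg_sub]; exact sub_le_self b ha.1) hb.1
  have hsmul : ∀ c ∈ D, ∀ r : ℝ, 0 ≤ r → r • c ∈ D := by
    intro c hc r hr
    have h1 : ∀ c : V → ℝ, (r • c) ⊔ 0 = r • (c ⊔ 0) := by
      intro c; ext v; simp [mul_max_of_nonneg _ _ hr]
    refine ⟨by rw [h1]; exact smul_mem_orthantComplex hc.1 hr, ?_⟩
    rw [← smul_neg, h1]; exact smul_mem_orthantComplex hc.2 hr
  have hcont : Continuous fun c => ‖Φ c‖ := Φ.continuous_of_finiteDimensional.norm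
  have key : ∃ m : ℝ, 0 < m ∧ ∀ c ∈ D, m * ‖c‖ ≤ ‖Φ c‖ := by
    have hcomp : IsCompact (D ∩ Metric.sphere (0 : V → ℝ) 1) :=
      (isCompact_sphere _ _).inter_left hDclosed
    rcases (D ∩ Metric.sphere (0 : V → ℝ) 1).eq_empty_or_nonempty with he | hne
    · refine ⟨1, one_pos, fun c hc => ?_⟩
      have : c = 0 := by
        by_contra h0
        have : ‖c‖⁻¹ • c ∈ D ∩ Metric.sphere (0 : V → ℝ) 1 :=
          ⟨hsmul c hc _ (by positivity), by simp [norm_smul, h0]⟩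
        rw [he] at this; exact this
      simp [this]
    · obtain ⟨c₀, hc₀, hmin⟩ := hcomp.exists_isMinOn hne hcont.continuousOn
      refine ⟨‖Φ c₀‖, norm_pos_iff.2 fun h0 => ?_, fun c hc => ?_⟩
      · have h1 := hDne c₀ hc₀.1 h0
        have h2 := hc₀.2
        simp [h1] at h2
      · rcases eq_or_ne c 0 with rfl | h0
        · simp
        · have hm : ‖c‖⁻¹ • c ∈ D ∩ Metric.sphere (0 : V → ℝ) 1 :=
            ⟨hsmul c hc _ (by positivity), by simp [norm_smul, h0]⟩
          have := hmin hm
          simp only [Set.mem_ofPred_eq, map_smul, norm_smul, norm_inv, norm_norm] at this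
          have hc0 : 0 < ‖c‖ := norm_pos_iff.2 h0
          rw [inv_mul_eq_div, le_div_iff₀ hc0] at this
          exact this
  obtain ⟨m, hm, h⟩ := key
  refine ⟨m⁻¹, inv_pos.2 hm, fun a ha b hb => ?_⟩
  have := h _ (hsub a ha b hb)
  rw [map_sub] at this
  rwa [inv_mul_eq_div, le_div_iff₀ hm, mul_comm]

/-- An orthant complex is a Lipschitz retract of its coordinate space. The retraction subtracts from
all coordinates the least `m ≥ 0` for which the positive part of the result lies in the complex;
this `m` is a `1`-Lipschitz function. -/
theorem exists_lipschitz_retraction_orthantComplex [Fintype V] (hS : S.Nonempty) :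
    ∃ r : (V → ℝ) → V → ℝ, LipschitzWith 2 r ∧ (∀ a, r a ∈ orthantComplex S) ∧
      ∀ a ∈ orthantComplex S, r a = a := by
  let P : ℝ → (V → ℝ) → V → ℝ := fun c a v => max (a v - c) 0
  let T : (V → ℝ) → Set ℝ := fun a => {c | 0 ≤ c ∧ P c a ∈ orthantComplex S}
  have hP0 : ∀ c a, 0 ≤ P c a := fun c a v => le_max_right _ _
  have hclosed : ∀ a, IsClosed (T a) := fun a =>
    (isClosed_le continuous_const continuous_id).inter
      (isClosed_orthantComplex.preimage (by fun_prop : Continuous fun c => P c a))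
  have hbdd : ∀ a, BddBelow (T a) := fun a => ⟨0, fun c hc => hc.1⟩
  have hne : ∀ a, (T a).Nonempty := fun a => ⟨‖a‖, norm_nonneg a, by
    have : P ‖a‖ a = 0 := by
      ext v
      have := (Real.le_norm_self _).trans (norm_le_pi_norm a v)
      simpa [P] using this
    rw [this]; exact zero_mem_orthantComplex hS⟩
  let m : (V → ℝ) → ℝ := fun a => sInf (T a)
  have hm : ∀ a, m a ∈ T a := fun a => (hclosed a).csInf_mem (hne a) (hbdd a)
  have hstep : ∀ a b, m b ≤ m a + dist a b := by
    intro a b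
    refine csInf_le (hbdd b) ⟨add_nonneg (hm a).1 dist_nonneg, ?_⟩
    refine mem_orthantComplex_of_le (hP0 _ _) (fun v => max_le_max ?_ le_rfl) (hm a).2
    have h := dist_le_pi_dist a b v
    rw [Real.dist_eq] at h
    have := neg_abs_le (a v - b v)
    linarith
  refine ⟨fun a => P (m a) a, LipschitzWith.of_dist_le_mul fun a b => ?_, fun a => (hm a).2,
    fun a ha => ?_⟩
  · rw [dist_pi_le_iff (by positivity)]
    intro v
    have h1 := hstep a b
    have h2 := hstep b a
    have h3 := dist_le_pi_dist a b v
    rw [dist_comm] at h2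
    rw [Real.dist_eq] at h3 ⊢
    refine (abs_max_sub_max_le_abs _ _ _).trans ?_
    rw [abs_le] at h3 ⊢
    push_cast
    constructor <;> linarith
  · have h0 : m a = 0 := by
      refine le_antisymm (csInf_le (hbdd a) ⟨le_rfl, ?_⟩) (hm a).1
      exact mem_orthantComplex_of_le (hP0 _ _) (fun v => max_le (sub_zero _).le (ha.1 v)) ha
    ext v
    simpa [P, h0] using ha.1 v

end OrthantComplex

/-! ### PL-embedded complexes and barycentric coordinates on their cones -/

section Chart

open Finset

universe u

variable {U : Type u} {E : Type*} [AddCommGroup U] [Module ℝ U] [AddCommGroup E] [Module ℝ E]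

theorem AffineIndependent.weights_eq {t : Finset U} (ht : AffineIndependent ℝ ((↑) : t → U))
    {w w' : U → ℝ} (h₁ : ∑ u ∈ t, w u = ∑ u ∈ t, w' u)
    (h₂ : ∑ u ∈ t, w u • u = ∑ u ∈ t, w' u • u) {u : U} (hu : u ∈ t) : w u = w' u := by
  have := ht.eq_zero_of_sum_eq_zero_subtype (w := fun u => w u - w' u)
    (by rw [sum_sub_distrib, h₁, sub_self])
    (by simp_rw [sub_smul]; rw [sum_sub_distrib, h₂, sub_self]) u hu
  linarith

theorem exists_weights_of_mem_convexHull_inter {s t : Finset U} {p : U}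
    (hp : p ∈ convexHull ℝ (s ∩ t : Set U)) :
    ∃ w : U → ℝ, (∀ u, 0 ≤ w u) ∧ (∀ u, u ∉ s ∨ u ∉ t → w u = 0) ∧ ∑ u ∈ s, w u = 1 ∧
      ∑ u ∈ s, w u • u = p := by
  classical
  rw [← coe_inter, Finset.mem_convexHull'] at hp
  obtain ⟨w, h0, h1, h2⟩ := hp
  refine ⟨fun u => if u ∈ s ∩ t then w u else 0, fun u => ?_, fun u hu => ?_, ?_, ?_⟩
  · dsimp only; split_ifs with h
    exacts [h0 u h, le_rfl]
  · exact if_neg (by rw [mem_inter]; tauto)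
  · rw [← h1, ← sum_subset (inter_subset_left : s ∩ t ⊆ s)]
    · exact sum_congr rfl fun u hu => if_pos hu
    · intro u _ hu; exact if_neg hu
  · rw [← h2, ← sum_subset (inter_subset_left : s ∩ t ⊆ s)]
    · exact sum_congr rfl fun u hu => by simp only [if_pos hu]
    · intro u _ hu; simp only [if_neg hu, zero_smul]

/-- Uniqueness of barycentric coordinates in a geometric simplicial complex. -/
theorem Geometry.SimplicialComplex.weights_eq (K : Geometry.SimplicialComplex ℝ U) {s t : Finset U}
    (hs : s ∈ K.faces) (ht : t ∈ K.faces) {w w' : U → ℝ} (hw : ∀ u, 0 ≤ w u) (hw' : ∀ u, 0 ≤ w' u)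
    (hws : ∀ u ∉ s, w u = 0) (hwt : ∀ u ∉ t, w' u = 0) (h1 : ∑ u ∈ s, w u = 1)
    (h1' : ∑ u ∈ t, w' u = 1) (h : ∑ u ∈ s, w u • u = ∑ u ∈ t, w' u • u) : w = w' := by
  have hp : ∑ u ∈ s, w u • u ∈ convexHull ℝ (s ∩ t : Set U) := K.inter_subset_convexHull hs ht
    ⟨Finset.mem_convexHull'.2 ⟨w, fun u _ => hw u, h1, rfl⟩,
      h ▸ Finset.mem_convexHull'.2 ⟨w', fun u _ => hw' u, h1', rfl⟩⟩
  obtain ⟨c, -, hc0, hc1, hc2⟩ := exists_weights_of_mem_convexHull_inter hp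
  obtain ⟨d, -, hd0, hd1, hd2⟩ := exists_weights_of_mem_convexHull_inter (Set.inter_comm _ _ ▸ hp)
  have e1 : w = c := by
    ext u
    by_cases hu : u ∈ s
    · exact (K.indep hs).weights_eq (h1.trans hc1.symm) hc2.symm hu
    · rw [hws u hu, hc0 u (Or.inl hu)]
  have e2 : w' = d := by
    ext u
    by_cases hu : u ∈ t
    · exact (K.indep ht).weights_eq (h1'.trans hd1.symm) (h.symm.trans hd2.symm) hu
    · rw [hwt u hu, hd0 u (Or.inl hu)]
  ext u
  by_cases hu : u ∈ s
  · have hsc : ∑ u ∈ s, d u = 1 ∧ ∑ u ∈ s, d u • u = ∑ u ∈ s, w u • u := by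
      classical
      rw [← hd1, ← hd2]
      constructor
      · rw [← sum_subset (inter_subset_left : s ∩ t ⊆ s) fun u _ hu => hd0 u (by
            rw [mem_inter] at hu; tauto),
          sum_subset (inter_subset_right : s ∩ t ⊆ t) fun u _ hu => hd0 u (by
            rw [mem_inter] at hu; tauto)]
      · rw [← sum_subset (inter_subset_left : s ∩ t ⊆ s) fun u _ hu => by
            rw [hd0 u (by rw [mem_inter] at hu; tauto), zero_smul],
          sum_subset (inter_subset_right : s ∩ t ⊆ t) fun u _ hu => by
            rw [hd0 u (by rw [mem_inter] at hu; tauto), zero_smul]]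
    rw [e2]
    exact (K.indep hs).weights_eq (h1.trans hsc.1.symm) hsc.2.symm hu
  · rw [hws u hu, e2, hd0 u (Or.inr hu)]

/-- The polyhedron of a subcomplex of `K` is a union of simplices of every subdivision `K'` of `K`.
The open simplex of `K'` that contains a given point of a simplex `s` of `K₀` lies in a simplex `t`
of `K` and meets its face `s ∩ t`, hence is contained in that face. -/
theorem Geometry.SimplicialComplex.exists_face_subset_space
    {K K' K₀ : Geometry.SimplicialComplex ℝ U}
    (hspace : K'.space = K.space)
    (hsub : ∀ s ∈ K'.faces, ∃ t ∈ K.faces, convexHull ℝ (s : Set U) ⊆ convexHull ℝ (t : Set U))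
    (hK₀ : K₀ ≤ K) {p : U} (hp : p ∈ K₀.space) :
    ∃ t ∈ K'.faces, convexHull ℝ (t : Set U) ⊆ K₀.space ∧ p ∈ convexHull ℝ (t : Set U) := by
  classical
  obtain ⟨s, hs, hps⟩ := mem_space_iff.1 hp
  have hpK' : p ∈ K'.space := hspace ▸ mem_space_iff.2 ⟨s, hK₀ hs, hps⟩
  obtain ⟨t', ht', hpt'⟩ := mem_space_iff.1 hpK'
  obtain ⟨r, hr, hr'⟩ := hsub t' ht'
  obtain ⟨w, hw0, hw1, hwp⟩ := Finset.mem_convexHull'.1 hpt'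
  let t := t'.filter fun u => 0 < w u
  have hw : ∀ u ∈ t', u ∉ t → w u = 0 := fun u hu hut => by
    have h1 := hw0 u hu
    have h2 : ¬ 0 < w u := fun h => hut (mem_filter.2 ⟨hu, h⟩)
    linarith
  have ht1 : ∑ u ∈ t, w u = 1 := by rw [← hw1]; exact sum_subset (filter_subset _ _) hw
  have htp : ∑ u ∈ t, w u • u = p := by
    rw [← hwp]
    exact sum_subset (filter_subset _ _) fun u hu hut => by rw [hw u hu hut, zero_smul]
  have htne : t.Nonempty := by
    rw [nonempty_iff_ne_empty]; intro h; rw [h] at ht1; simp at ht1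
  have htK' : t ∈ K'.faces := K'.down_closed ht' (filter_subset _ _) htne
  refine ⟨t, htK', ?_,
    Finset.mem_convexHull'.2 ⟨w, fun u hu => hw0 u (mem_filter.1 hu).1, ht1, htp⟩⟩
  have hB : ∀ v ∈ t, ∃ b : U → ℝ, (∀ u ∈ r, 0 ≤ b u) ∧ ∑ u ∈ r, b u = 1 ∧ ∑ u ∈ r, b u • u = v :=
    fun v hv => Finset.mem_convexHull'.1 (hr' (subset_convexHull ℝ _ (mem_filter.1 hv).1))
  choose! b hb0 hb1 hb2 using hB
  have hprs := K.inter_subset_convexHull hr (hK₀ hs) ⟨hr' hpt', hps⟩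
  obtain ⟨c, -, hc0, hc1, hc2⟩ := exists_weights_of_mem_convexHull_inter hprs
  have hsum : ∀ u ∈ r, ∑ v ∈ t, w v * b v u = c u := by
    intro u hu
    refine (K.indep hr).weights_eq (w := fun u => ∑ v ∈ t, w v * b v u) ?_ ?_ hu
    · rw [sum_comm, hc1, ← ht1]
      exact sum_congr rfl fun v hv => by rw [← mul_sum, hb1 v hv, mul_one]
    · simp_rw [sum_smul]
      rw [sum_comm, hc2, ← htp]
      refine sum_congr rfl fun v hv => ?_
      simp_rw [mul_smul]
      rw [← smul_sum, hb2 v hv]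
  have hts : (t : Set U) ⊆ convexHull ℝ (s : Set U) := by
    intro v hv
    have hbz : ∀ u ∈ r, u ∉ s → b v u = 0 := by
      intro u hu hus
      have h0 := hsum u hu
      rw [hc0 u (Or.inr hus), sum_eq_zero_iff_of_nonneg fun v hv =>
        mul_nonneg (mem_filter.1 hv).2.le (hb0 v hv u hu)] at h0
      exact (mul_eq_zero.1 (h0 v hv)).resolve_left (mem_filter.1 hv).2.ne'
    refine convexHull_mono (s := ((r ∩ s : Finset U) : Set U)) (by simp) ?_
    refine Finset.mem_convexHull'.2 ⟨b v, fun u hu => hb0 v hv u (mem_inter.1 hu).1, ?_, ?_⟩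
    · rw [← hb1 v hv]
      exact sum_subset inter_subset_left fun u hu hur => hbz u hu fun hus =>
        hur (mem_inter.2 ⟨hu, hus⟩)
    · refine Eq.trans (sum_subset inter_subset_left fun u hu hur => ?_) (hb2 v hv)
      rw [hbz u hu fun hus => hur (mem_inter.2 ⟨hu, hus⟩), zero_smul]
  exact (convexHull_min hts (convex_convexHull ℝ _)).trans (convexHull_subset_space hs)

theorem AffineMap.map_sum_smul (a : U →ᵃ[ℝ] E) {t : Finset U} {w : U → ℝ} (hw : ∑ u ∈ t, w u = 1) :
    a (∑ u ∈ t, w u • u) = ∑ u ∈ t, w u • a u := by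
  rw [a.decomp]
  simp only [Pi.add_apply, map_sum, map_smul, smul_add, sum_add_distrib, ← sum_smul, hw, one_smul]

/-- The linear map sending barycentric coordinates on a cone, with respect to vertices `e v`, to the
corresponding point of the cone. -/
def coneCoord {V : Type*} [Fintype V] (e : V → E) : (V → ℝ) →ₗ[ℝ] E × ℝ :=
  Fintype.linearCombination ℝ fun v => (e v, (1 : ℝ))

theorem coneCoord_apply {V : Type*} [Fintype V] (e : V → E) (c : V → ℝ) :
    coneCoord e c = (∑ v, c v • e v, ∑ v, c v) := by
  simp [coneCoord, Fintype.linearCombination_apply, Prod.ext_iff, Prod.fst_sum, Prod.snd_sum]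

/-- Cones over PL-embedded complexes and over their subcomplexes are simultaneously linear images of
orthant complexes. The vertices are those of a subdivision on whose simplices the embedding is
affine. -/
theorem IsPLEmbedding.exists_coneCoord {K : Geometry.SimplicialComplex ℝ U} {i : U → E}
    (hi : IsPLEmbedding K i) :
    ∃ (V : Type u) (_ : Fintype V) (e : V → E) (S : Geometry.SimplicialComplex ℝ U → Set (Set V)),
      Set.InjOn (coneCoord e) (orthantComplex (S K)) ∧ ∀ K₀ ≤ K, S K₀ ⊆ S K ∧
        cone (i '' K₀.space) = coneCoord e '' orthantComplex (S K₀) := by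
  classical
  obtain ⟨hinj, K', hfin, hspace, hsub, haff⟩ := hi
  let N : Finset U := hfin.toFinset.biUnion id
  have hN : ∀ t ∈ K'.faces, t ⊆ N := fun t ht u hu =>
    mem_biUnion.2 ⟨t, hfin.mem_toFinset.2 ht, hu⟩
  -- extension of coordinates by zero to all points of the ambient space
  let x : (N → ℝ) → U → ℝ := fun c u => if h : u ∈ N then c ⟨u, h⟩ else 0
  have hx : ∀ c (v : N), x c v = c v := fun c v => dif_pos v.2
  have hsum : ∀ (c : N → ℝ) (t : Finset U), t ∈ K'.faces → (∀ v : N, (v : U) ∉ t → c v = 0) →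
      ∑ v : N, c v • i v = ∑ u ∈ t, x c u • i u := by
    intro c t ht hc
    rw [sum_subset (hN t ht), ← sum_coe_sort N]
    · exact sum_congr rfl fun v _ => by rw [hx]
    · intro u hu hut
      rw [show x c u = c ⟨u, hu⟩ from hx c ⟨u, hu⟩, hc ⟨u, hu⟩ hut, zero_smul]
  have hsum' : ∀ (c : N → ℝ) (t : Finset U), t ∈ K'.faces → (∀ v : N, (v : U) ∉ t → c v = 0) →
      ∑ v : N, c v = ∑ u ∈ t, x c u := by
    intro c t ht hc
    rw [sum_subset (hN t ht), ← sum_coe_sort N]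
    · exact sum_congr rfl fun v _ => by rw [hx]
    · intro u hu hut
      rw [show x c u = c ⟨u, hu⟩ from hx c ⟨u, hu⟩, hc ⟨u, hu⟩ hut]
  have hx0 : ∀ c : N → ℝ, 0 ≤ c → ∀ u, 0 ≤ x c u := by
    intro c hc u
    simp only [x]; split_ifs with h
    exacts [hc _, le_rfl]
  have hxz : ∀ (c : N → ℝ) (t : Finset U), (∀ v : N, (v : U) ∉ t → c v = 0) →
      ∀ u ∉ t, x c u = 0 := by
    intro c t hc u hu
    simp only [x]; split_ifs with h
    exacts [hc _ hu, rfl]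
  have hmap : ∀ t ∈ K'.faces, ∀ w : U → ℝ, (∀ u, 0 ≤ w u) → ∑ u ∈ t, w u = 1 →
      i (∑ u ∈ t, w u • u) = ∑ u ∈ t, w u • i u := by
    intro t ht w hw0 hw1
    obtain ⟨a, ha⟩ := haff t ht
    rw [ha (Finset.mem_convexHull'.2 ⟨w, fun u _ => hw0 u, hw1, rfl⟩), a.map_sum_smul hw1]
    exact sum_congr rfl fun u hu => by rw [ha (subset_convexHull ℝ _ hu)]
  have key : ∀ (c : N → ℝ) (t : Finset U), t ∈ K'.faces → 0 ≤ c →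
      (∀ v : N, (v : U) ∉ t → c v = 0) → 0 < ∑ v, c v →
      ∃ w : U → ℝ, (∀ u, 0 ≤ w u) ∧ (∀ u ∉ t, w u = 0) ∧ ∑ u ∈ t, w u = 1 ∧
        (∀ v : N, c v = (∑ v, c v) * w v) ∧
        coneCoord (fun v : N => i v) c = ((∑ v, c v) • i (∑ u ∈ t, w u • u), ∑ v, c v) := by
    intro c t ht hc0 hct hm
    set m := ∑ v, c v with hmdef
    have h1 : ∑ u ∈ t, m⁻¹ * x c u = 1 := by
      rw [← mul_sum, ← hsum' c t ht hct, inv_mul_cancel₀ hm.ne']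
    refine ⟨fun u => m⁻¹ * x c u, fun u => mul_nonneg (inv_nonneg.2 hm.le) (hx0 c hc0 u),
      fun u hu => by simp only [hxz c t hct u hu, mul_zero], h1, fun v => ?_, ?_⟩
    · simp only [hx, mul_inv_cancel_left₀ hm.ne']
    · rw [coneCoord_apply, hmap t ht _ (fun u => mul_nonneg (inv_nonneg.2 hm.le) (hx0 c hc0 u)) h1,
        hsum c t ht hct, smul_sum]
      congr 1
      exact sum_congr rfl fun u _ => by rw [smul_smul, mul_inv_cancel_left₀ hm.ne']
  refine ⟨N, inferInstance, fun v => i v,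
    fun K₀ => {s | ∃ t ∈ K'.faces, convexHull ℝ (t : Set U) ⊆ K₀.space ∧ s = {v : N | (v : U) ∈ t}},
    ?_, fun K₀ hK₀ => ⟨?_, ?_⟩⟩
  · rintro c ⟨hc0, _, ⟨s, hs, -, rfl⟩, hcs⟩ d ⟨hd0, _, ⟨t, ht, -, rfl⟩, hdt⟩ h
    have hm : ∑ v, c v = ∑ v, d v := by
      have := congrArg Prod.snd h
      simpa only [coneCoord_apply] using this
    rcases (sum_nonneg fun v _ => hc0 v : 0 ≤ ∑ v, c v).eq_or_lt with h0 | h0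
    · have h1 := (sum_eq_zero_iff_of_nonneg fun v _ => hc0 v).1 h0.symm
      have h2 := (sum_eq_zero_iff_of_nonneg fun v _ => hd0 v).1 (hm.symm.trans h0.symm)
      ext v; rw [h1 v (mem_univ v), h2 v (mem_univ v)]
    · obtain ⟨w, hw0, hws, hw1, hcw, hcΦ⟩ := key c s hs hc0 hcs h0
      obtain ⟨w', hw0', hwt, hw1', hdw, hdΦ⟩ := key d t ht hd0 hdt (hm ▸ h0)
      rw [hcΦ, hdΦ, hm] at h
      have hii := smul_right_injective E (hm ▸ h0).ne' (congrArg Prod.fst h)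
      have hpp := hinj (hspace ▸ K'.convexHull_subset_space hs
          (Finset.mem_convexHull'.2 ⟨w, fun u _ => hw0 u, hw1, rfl⟩))
        (hspace ▸ K'.convexHull_subset_space ht
          (Finset.mem_convexHull'.2 ⟨w', fun u _ => hw0' u, hw1', rfl⟩)) hii
      have := K'.weights_eq hs ht hw0 hw0' hws hwt hw1 hw1' hpp
      ext v; rw [hcw, hdw, hm, this]
  · rintro _ ⟨t, ht, hts, rfl⟩
    refine ⟨t, ht, hts.trans fun p hp => ?_, rfl⟩
    obtain ⟨s, hs, hps⟩ := Geometry.SimplicialComplex.mem_space_iff.1 hp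
    exact Geometry.SimplicialComplex.mem_space_iff.2 ⟨s, hK₀ hs, hps⟩
  · ext z
    constructor
    · rintro ⟨_, ⟨p, hp, rfl⟩, h, hh, rfl⟩
      obtain ⟨t, ht, hts, hpt⟩ :=
        Geometry.SimplicialComplex.exists_face_subset_space hspace hsub hK₀ hp
      rw [← Set.inter_self (convexHull ℝ (t : Set U)),
        K'.convexHull_inter_convexHull ht ht] at hpt
      obtain ⟨w, hw0, hwt, hw1, hwp⟩ := exists_weights_of_mem_convexHull_inter hpt
      have hc : ∀ v : N, (v : U) ∉ t → h * w v = 0 := fun v hv => by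
        rw [hwt v (Or.inl hv), mul_zero]
      have hxw : ∀ u ∈ t, x (fun v : N => h * w v) u = h * w u := fun u hu =>
        hx (fun v : N => h * w v) ⟨u, hN t ht hu⟩
      refine ⟨fun v => h * w v, ⟨fun v => mul_nonneg hh (hw0 v), _, ⟨t, ht, hts, rfl⟩, hc⟩, ?_⟩
      rw [coneCoord_apply, hsum _ t ht hc, hsum' _ t ht hc, sum_congr rfl hxw, ← mul_sum, hw1,
        mul_one, ← hwp, hmap t ht w hw0 hw1, smul_sum]
      congr 1
      exact sum_congr rfl fun u hu => by rw [hxw u hu, mul_smul]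
    · rintro ⟨c, ⟨hc0, _, ⟨t, ht, hts, rfl⟩, hct⟩, rfl⟩
      rcases (sum_nonneg fun v _ => hc0 v : 0 ≤ ∑ v, c v).eq_or_lt with h0 | h0
      · obtain ⟨u, hu⟩ := K'.nonempty_of_mem_faces ht
        refine ⟨i u, ⟨u, hts (subset_convexHull ℝ _ hu), rfl⟩, 0, le_rfl, ?_⟩
        have : c = 0 := by
          ext v; exact (sum_eq_zero_iff_of_nonneg fun v _ => hc0 v).1 h0.symm v (mem_univ v)
        rw [this, map_zero, zero_smul]; rfl
      · obtain ⟨w, hw0, hws, hw1, -, hcΦ⟩ := key c t ht hc0 hct h0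
        exact ⟨_, ⟨_, hts (Finset.mem_convexHull'.2 ⟨w, fun u _ => hw0 u, hw1, rfl⟩), rfl⟩, _,
          h0.le, hcΦ⟩

end Chart

/-! ### Metric geometry of cones over PL-embedded complexes -/

section ConeGeometry

theorem smul_mem_cone {E : Type*} [AddCommGroup E] [Module ℝ E] {X : Set E} {z : E × ℝ}
    (hz : z ∈ cone X) {r : ℝ} (hr : 0 ≤ r) : r • z ∈ cone X := by
  obtain ⟨x, hx, h, hh, rfl⟩ := hz
  exact ⟨x, hx, r * h, mul_nonneg hr hh, by simp [mul_smul]⟩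

theorem cone_mono {E : Type*} [AddCommGroup E] [Module ℝ E] {X X' : Set E} (h : X ⊆ X') :
    cone X ⊆ cone X' :=
  fun _ ⟨x, hx, hz⟩ => ⟨x, h hx, hz⟩

variable {U E : Type*} [AddCommGroup U] [Module ℝ U] [NormedAddCommGroup E] [NormedSpace ℝ E]
  {K : Geometry.SimplicialComplex ℝ U} {i : U → E}

/-- Two points `a`, `b` of the cone are joined, inside the cone, by a broken line `a`, `z`, `b`
whose length is at most a constant times the distance of `a` and `b`, and `z` lies in every subcone
that contains `a` or `b`: take `z` to be the minimum of `a` and `b` in barycentric coordinates. -/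
theorem IsPLEmbedding.exists_broken_line (hi : IsPLEmbedding K i) :
    ∃ C : ℝ, 0 < C ∧ ∀ a ∈ cone (i '' K.space), ∀ b ∈ cone (i '' K.space), ∃ z : E × ℝ,
      segment ℝ a z ⊆ cone (i '' K.space) ∧ segment ℝ z b ⊆ cone (i '' K.space) ∧
      dist a z ≤ C * dist a b ∧ dist z b ≤ C * dist a b ∧
      ∀ K₀ ≤ K, a ∈ cone (i '' K₀.space) ∨ b ∈ cone (i '' K₀.space) →
        z ∈ cone (i '' K₀.space) := by
  obtain ⟨V, _, e, S, hinj, hS⟩ := hi.exists_coneCoord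
  obtain ⟨C, hC, hbil⟩ := exists_norm_sub_le_of_injOn_orthantComplex _ hinj
  let Φ := LinearMap.toContinuousLinearMap (coneCoord e)
  have hΦ : ∀ c, Φ c = coneCoord e c := fun c => rfl
  have hK := (hS K le_rfl).2
  have hseg : ∀ a b : V → ℝ, 0 ≤ a → a ≤ b → b ∈ orthantComplex (S K) →
      segment ℝ (Φ b) (Φ a) ⊆ cone (i '' K.space) := by
    intro a b h0 hab hb
    have h1 : segment ℝ (Φ b) (Φ a) = coneCoord e '' segment ℝ b a :=
      (image_segment ℝ (coneCoord e).toAffineMap b a).symm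
    rw [h1, hK]
    exact Set.image_mono (segment_subset_orthantComplex h0 hab hb)
  have hinf : ∀ a b : V → ℝ, ‖a - a ⊓ b‖ ≤ ‖a - b‖ := by
    intro a b
    refine (pi_norm_le_iff_of_nonneg (norm_nonneg _)).2 fun v => ?_
    refine le_trans ?_ (norm_le_pi_norm (a - b) v)
    simp only [Pi.sub_apply, Pi.inf_apply, Real.norm_eq_abs]
    grind
  refine ⟨(‖Φ‖ + 1) * C, by positivity, fun a ha b hb => ?_⟩
  rw [hK] at ha hb
  obtain ⟨a, ha, rfl⟩ := ha
  obtain ⟨b, hb, rfl⟩ := hb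
  have h0 : 0 ≤ a ⊓ b := le_inf ha.1 hb.1
  have hdist : ∀ c c' : V → ℝ, ‖c - c'‖ ≤ ‖a - b‖ →
      dist (Φ c) (Φ c') ≤ (‖Φ‖ + 1) * C * dist (Φ a) (Φ b) := by
    intro c c' h
    rw [dist_eq_norm, ← map_sub]
    calc ‖Φ (c - c')‖ ≤ ‖Φ‖ * ‖c - c'‖ := Φ.le_opNorm _
      _ ≤ (‖Φ‖ + 1) * ‖a - b‖ := by gcongr; linarith
      _ ≤ (‖Φ‖ + 1) * (C * ‖Φ a - Φ b‖) := by
        have := hbil a ha b hb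
        gcongr
        exact this
      _ = _ := by rw [dist_eq_norm, mul_assoc]
  refine ⟨Φ (a ⊓ b), hseg _ _ h0 inf_le_left ha, ?_, hdist _ _ (hinf a b), hdist _ _ ?_,
    fun K₀ hK₀ h => ?_⟩
  · rw [segment_symm]; exact hseg _ _ h0 inf_le_right hb
  · rw [norm_sub_rev, inf_comm, norm_sub_rev a b]; exact hinf b a
  · obtain ⟨hsub, h2⟩ := hS K₀ hK₀
    rw [h2] at h ⊢
    refine ⟨a ⊓ b, ?_, rfl⟩
    rcases h with ⟨c, hc, h⟩ | ⟨c, hc, h⟩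
    · rw [hinj (orthantComplex_mono hsub hc) ha h] at hc
      exact mem_orthantComplex_of_le h0 inf_le_left hc
    · rw [hinj (orthantComplex_mono hsub hc) hb h] at hc
      exact mem_orthantComplex_of_le h0 inf_le_right hc

/-- The cone over a subcomplex of a PL-embedded complex is a Lipschitz retract of the ambient
space. -/
theorem IsPLEmbedding.exists_lipschitz_retraction (hi : IsPLEmbedding K i)
    {K₀ : Geometry.SimplicialComplex ℝ U} (hK₀ : K₀ ≤ K) (hne : (cone (i '' K₀.space)).Nonempty) :
    ∃ (r : E × ℝ → E × ℝ) (C : ℝ≥0), LipschitzWith C r ∧ (∀ z, r z ∈ cone (i '' K₀.space)) ∧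
      ∀ z ∈ cone (i '' K₀.space), r z = z := by
  obtain ⟨V, _, e, S, hinj, hS⟩ := hi.exists_coneCoord
  obtain ⟨hsub, hcone⟩ := hS K₀ hK₀
  have hinj₀ := hinj.mono (orthantComplex_mono hsub)
  obtain ⟨C, hC, hbil⟩ := exists_norm_sub_le_of_injOn_orthantComplex _ hinj₀
  let Φ := LinearMap.toContinuousLinearMap (coneCoord e)
  have hΦ : ∀ c, Φ c = coneCoord e c := fun c => rfl
  have hSne : (S K₀).Nonempty := by
    rw [hcone, Set.image_nonempty] at hne
    obtain ⟨c, -, s, hs, -⟩ := hne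
    exact ⟨s, hs⟩
  obtain ⟨P, hP, hPmem, hPid⟩ := exists_lipschitz_retraction_orthantComplex hSne
  set inv := Function.invFunOn (coneCoord e) (orthantComplex (S K₀))
  have hinv : ∀ c ∈ orthantComplex (S K₀), inv (coneCoord e c) = c := fun c hc =>
    hinj₀.leftInvOn_invFunOn hc
  have hlip : LipschitzOnWith C.toNNReal inv (cone (i '' K₀.space)) := by
    refine LipschitzOnWith.of_dist_le_mul fun x hx y hy => ?_
    rw [hcone] at hx hy
    obtain ⟨a, ha, rfl⟩ := hx
    obtain ⟨b, hb, rfl⟩ := hy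
    rw [hinv a ha, hinv b hb, dist_eq_norm, dist_eq_norm, Real.coe_toNNReal _ hC.le]
    exact hbil a ha b hb
  obtain ⟨Λ, hΛ, heq⟩ := hlip.extend_pi
  refine ⟨fun z => Φ (P (Λ z)), _, Φ.lipschitz.comp (hP.comp hΛ), fun z => ?_, fun z hz => ?_⟩
  · rw [hcone]; exact ⟨_, hPmem _, rfl⟩
  · dsimp only
    rw [← heq hz]
    rw [hcone] at hz
    obtain ⟨c, hc, rfl⟩ := hz
    rw [hinv c hc, hPid c hc, hΦ]

theorem IsPLEmbedding.isClosed_cone (hi : IsPLEmbedding K i) : IsClosed (cone (i '' K.space)) := by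
  rcases (cone (i '' K.space)).eq_empty_or_nonempty with h | h
  · rw [h]; exact isClosed_empty
  · obtain ⟨r, C, hr, hmem, hid⟩ := hi.exists_lipschitz_retraction le_rfl h
    have : cone (i '' K.space) = {z | r z = z} :=
      Set.Subset.antisymm hid fun z hz => (show r z = z from hz) ▸ hmem z
    rw [this]
    exact isClosed_eq hr.continuous continuous_id

/-- The norm on a cone with bounded base is controlled by the height. -/
theorem IsPLEmbedding.exists_norm_le_mul_snd (hi : IsPLEmbedding K i) :
    ∃ R : ℝ, 1 ≤ R ∧ ∀ z ∈ cone (i '' K.space), ‖z‖ ≤ R * z.2 := by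
  obtain ⟨V, _, e, S, -, hS⟩ := hi.exists_coneCoord
  refine ⟨1 + ∑ v, ‖(e v, (1 : ℝ))‖, by
    have : 0 ≤ ∑ v, ‖(e v, (1 : ℝ))‖ := Finset.sum_nonneg fun v _ => norm_nonneg _
    linarith, fun z hz => ?_⟩
  rw [(hS K le_rfl).2] at hz
  obtain ⟨c, hc, rfl⟩ := hz
  have h2 : (coneCoord e c).2 = ∑ v, c v := by rw [coneCoord_apply]
  have h1 : coneCoord e c = ∑ v, c v • (e v, (1 : ℝ)) := by
    rw [coneCoord, Fintype.linearCombination_apply]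
  rw [h2, h1, Finset.mul_sum]
  refine (norm_sum_le _ _).trans (Finset.sum_le_sum fun v _ => ?_)
  rw [norm_smul, Real.norm_of_nonneg (hc.1 v), mul_comm]
  refine mul_le_mul_of_nonneg_right ?_ (hc.1 v)
  have := Finset.single_le_sum (f := fun v => ‖(e v, (1 : ℝ))‖) (fun v _ => norm_nonneg _)
    (Finset.mem_univ v)
  linarith

end ConeGeometry

/-! ### Lipschitz approximation of coarse maps -/

section Approximation

/-- A map that is controlled at scale `2` grows at most linearly along segments. -/
theorem dist_le_of_segment_subset {W B : Type*} [NormedAddCommGroup W] [NormedSpace ℝ W]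
    [PseudoMetricSpace B] {A : Set W} {φ : W → B} {S : ℝ}
    (hφ : ∀ x ∈ A, ∀ y ∈ A, dist x y < 2 → dist (φ x) (φ y) ≤ S) {x y : W}
    (hxy : segment ℝ x y ⊆ A) : dist (φ x) (φ y) ≤ S * (dist x y + 1) := by
  set n := ⌊dist x y⌋₊ + 1 with hn
  have hn0 : (0 : ℝ) < n := by rw [hn]; positivity
  have hdn : dist x y < n := by rw [hn]; push_cast; exact Nat.lt_floor_add_one _
  have hS : 0 ≤ S := dist_nonneg.trans
    (hφ x (hxy (left_mem_segment ℝ x y)) x (hxy (left_mem_segment ℝ x y)) (by simp))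
  let p : ℕ → W := fun k => AffineMap.lineMap x y ((k : ℝ) / n)
  have hp : ∀ k ≤ n, p k ∈ A := fun k hk => hxy (by
    rw [segment_eq_image_lineMap]
    exact ⟨_, ⟨by positivity, (div_le_one hn0).2 (by exact_mod_cast hk)⟩, rfl⟩)
  have hstep : ∀ k ∈ Finset.range n, dist (φ (p k)) (φ (p (k + 1))) ≤ S := by
    intro k hk
    have hk := Finset.mem_range.1 hk
    refine hφ _ (hp k hk.le) _ (hp (k + 1) hk) ?_
    rw [dist_lineMap_lineMap, Real.dist_eq]
    have : ((k : ℝ) / n - ((k + 1 : ℕ) : ℝ) / n) = -(1 / n) := by push_cast; ring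
    rw [this, abs_neg, abs_of_pos (by positivity), one_div, inv_mul_eq_div]
    have : dist x y / n < 1 := (div_lt_one hn0).2 hdn
    linarith
  have h0 : p 0 = x := by simp [p]
  have h1 : p n = y := by simp [p, hn0.ne']
  calc dist (φ x) (φ y) = dist (φ (p 0)) (φ (p n)) := by rw [h0, h1]
    _ ≤ ∑ k ∈ Finset.range n, dist (φ (p k)) (φ (p (k + 1))) :=
      dist_le_range_sum_dist (fun k => φ (p k)) n
    _ ≤ ∑ k ∈ Finset.range n, S := Finset.sum_le_sum hstep
    _ = S * n := by simp [mul_comm]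
    _ ≤ S * (dist x y + 1) := by
      have := Nat.floor_le (dist_nonneg (x := x) (y := y))
      gcongr
      rw [hn]; push_cast; linarith

/-- A subset `B` of `Z` extends to a set that is `1`-dense in `Z` and all of whose points outside
`B` have distance at least `1` from all other points. -/
theorem exists_separated_superset {α : Type*} [PseudoMetricSpace α] {B Z : Set α} (hBZ : B ⊆ Z) :
    ∃ N : Set α, B ⊆ N ∧ N ⊆ Z ∧
      (∀ x ∈ N, ∀ y ∈ N, x ≠ y → ¬(x ∈ B ∧ y ∈ B) → 1 ≤ dist x y) ∧
      ∀ z ∈ Z, ∃ x ∈ N, dist z x < 1 := by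
  obtain ⟨N, hBN, hmax⟩ := zorn_subset_nonempty
    {N : Set α | N ⊆ Z ∧ ∀ x ∈ N, ∀ y ∈ N, x ≠ y → ¬(x ∈ B ∧ y ∈ B) → 1 ≤ dist x y} (by
      intro c hc hchain _
      refine ⟨⋃₀ c, ⟨Set.sUnion_subset fun s hs => (hc hs).1, ?_⟩,
        fun s hs => Set.subset_sUnion_of_mem hs⟩
      rintro x ⟨s, hs, hxs⟩ y ⟨t, ht, hyt⟩ hxy hB
      rcases hchain.total hs ht with h | h
      · exact (hc ht).2 x (h hxs) y hyt hxy hB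
      · exact (hc hs).2 x hxs y (h hyt) hxy hB) B
    ⟨hBZ, fun x hx y hy _ h => absurd ⟨hx, hy⟩ h⟩
  refine ⟨N, hBN, hmax.prop.1, hmax.prop.2, fun z hz => ?_⟩
  by_contra! hfar
  have hins : insert z N ⊆ N := by
    refine hmax.le_of_ge ⟨Set.insert_subset hz hmax.prop.1, ?_⟩ (Set.subset_insert z N)
    rintro x (rfl | hx) y (rfl | hy) hxy hB
    · exact absurd rfl hxy
    · exact hfar y hy
    · rw [dist_comm]; exact hfar x hx
    · exact hmax.prop.2 x hx y hy hxy hB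
  have := hfar z (hins (Set.mem_insert z N))
  rw [dist_self] at this
  linarith

/-- A large-scale Lipschitz map into a Lipschitz retract `Q` of a finite-dimensional space is at
bounded distance from a Lipschitz map into `Q` that agrees with it on a given set `B` on which it is
Lipschitz: extend the restriction of the map to a separated net containing `B`. -/
theorem exists_lipschitz_approximation {α F : Type*} [PseudoMetricSpace α] [NormedAddCommGroup F]
    [NormedSpace ℝ F] [FiniteDimensional ℝ F] {Z B : Set α} {Q : Set F} (hBZ : B ⊆ Z)
    (hQ : Q.Nonempty → ∃ (r : F → F) (C : ℝ≥0), LipschitzWith C r ∧ (∀ z, r z ∈ Q) ∧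
      ∀ z ∈ Q, r z = z)
    {φ : α → F} (hφQ : Set.MapsTo φ Z Q) {c : ℝ} (hc : 0 ≤ c)
    (hφ : ∀ x ∈ Z, ∀ y ∈ Z, dist (φ x) (φ y) ≤ c * dist x y + c) {C : ℝ≥0}
    (hφB : LipschitzOnWith C φ B) :
    ∃ (ψ : α → F) (C' : ℝ≥0) (D : ℝ), LipschitzOnWith C' ψ Z ∧ Set.MapsTo ψ Z Q ∧
      Set.EqOn ψ φ B ∧ ∀ z ∈ Z, dist (ψ z) (φ z) ≤ D := by
  rcases Q.eq_empty_or_nonempty with rfl | hne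
  · have hZ : Z = ∅ := by
      rw [Set.eq_empty_iff_forall_notMem]; exact fun z hz => hφQ hz
    subst hZ
    exact ⟨φ, 0, 0, by simp, hφQ, fun _ _ => rfl, by simp⟩
  obtain ⟨r, Cr, hr, hrQ, hrid⟩ := hQ hne
  obtain ⟨N, hBN, hNZ, hsep, hdense⟩ := exists_separated_superset hBZ
  have hNlip : LipschitzOnWith (C + (2 * c).toNNReal) φ N := by
    refine LipschitzOnWith.of_dist_le_mul fun x hx y hy => ?_
    push_cast
    rw [Real.coe_toNNReal _ (by positivity)]
    by_cases hB : x ∈ B ∧ y ∈ B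
    · refine (hφB.dist_le_mul x hB.1 y hB.2).trans ?_
      gcongr
      linarith
    · rcases eq_or_ne x y with rfl | hxy
      · simp
      · have h1 := hsep x hx y hy hxy hB
        have h2 := hφ x (hNZ hx) y (hNZ hy)
        have h3 : 0 ≤ C * dist x y := by positivity
        nlinarith
  obtain ⟨ψ, hψ, heq⟩ := hNlip.extend_finite_dimension
  set L := lipschitzExtensionConstant F * (C + (2 * c).toNNReal)
  have hrψ : LipschitzWith (Cr * L) (r ∘ ψ) := hr.comp hψ
  have hN : ∀ x ∈ N, (r ∘ ψ) x = φ x := fun x hx => by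
    rw [Function.comp_apply, ← heq hx, hrid _ (hφQ (hNZ hx))]
  refine ⟨r ∘ ψ, Cr * L, (Cr * L : ℝ≥0) + 2 * c, hrψ.lipschitzOnWith, fun z _ => hrQ _,
    fun x hx => hN x (hBN hx), fun z hz => ?_⟩
  obtain ⟨x, hx, hzx⟩ := hdense z hz
  calc dist ((r ∘ ψ) z) (φ z) ≤ dist ((r ∘ ψ) z) ((r ∘ ψ) x) + dist (φ x) (φ z) := by
        rw [← hN x hx]; exact dist_triangle _ _ _
    _ ≤ (Cr * L : ℝ≥0) * dist z x + (c * dist x z + c) :=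
      add_le_add (hrψ.dist_le_mul z x) (hφ x (hNZ hx) z hz)
    _ ≤ (Cr * L : ℝ≥0) * 1 + (c * 1 + c) := by
      rw [dist_comm x z]; gcongr
    _ = _ := by ring

/-- A map that is Lipschitz on `A` and on `B` is Lipschitz on `A ∪ B` if points of `A` and `B` are
joined, without essential detour, through points of `A ∩ B`. -/
theorem LipschitzOnWith.union_of_broken_line {α β : Type*} [PseudoMetricSpace α]
    [PseudoMetricSpace β] {A B : Set α} {φ : α → β} {C : ℝ≥0} (hA : LipschitzOnWith C φ A)
    (hB : LipschitzOnWith C φ B) {c : ℝ≥0}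
    (h : ∀ a ∈ A, ∀ b ∈ B, ∃ z ∈ A ∩ B, dist a z ≤ c * dist a b ∧ dist z b ≤ c * dist a b) :
    LipschitzOnWith (C + 2 * C * c) φ (A ∪ B) := by
  have key : ∀ a ∈ A, ∀ b ∈ B, dist (φ a) (φ b) ≤ (C + 2 * C * c : ℝ≥0) * dist a b := by
    intro a ha b hb
    obtain ⟨z, ⟨hzA, hzB⟩, h1, h2⟩ := h a ha b hb
    calc dist (φ a) (φ b) ≤ dist (φ a) (φ z) + dist (φ z) (φ b) := dist_triangle _ _ _
      _ ≤ C * dist a z + C * dist z b :=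
        add_le_add (hA.dist_le_mul a ha z hzA) (hB.dist_le_mul z hzB b hb)
      _ ≤ C * (c * dist a b) + C * (c * dist a b) + C * dist a b := by
        have : 0 ≤ C * dist a b := by positivity
        have : C * dist a z + C * dist z b ≤ C * (c * dist a b) + C * (c * dist a b) := by gcongr
        linarith
      _ = _ := by push_cast; ring
  have hle : C ≤ C + 2 * C * c := le_self_add
  refine LipschitzOnWith.of_dist_le_mul ?_
  rintro x (hx | hx) y (hy | hy)
  · exact (hA.weaken hle).dist_le_mul x hx y hy
  · exact key x hx y hy
  · rw [dist_comm, dist_comm x]; exact key y hy x hx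
  · exact (hB.weaken hle).dist_le_mul x hx y hy

variable {U U' E E' : Type*} [AddCommGroup U] [Module ℝ U] [AddCommGroup U'] [Module ℝ U']
  [NormedAddCommGroup E] [NormedSpace ℝ E] [NormedAddCommGroup E'] [NormedSpace ℝ E']
  [FiniteDimensional ℝ E']

/-- A coarse map of pairs between cones over PL-embedded complexes that is Lipschitz on a subcone is
at bounded distance, relative to that subcone, from a Lipschitz map of pairs. The approximation is
constructed on the cone over the subcomplex `K₀` of the pair first. -/
theorem IsCoarsePairMap.exists_lipschitz_approximation {K K₀ K₁ : Geometry.SimplicialComplex ℝ U}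
    {M M₀ : Geometry.SimplicialComplex ℝ U'} {i : U → E} {j : U' → E'} (hi : IsPLEmbedding K i)
    (hj : IsPLEmbedding M j) (hK₀ : K₀ ≤ K) (hK₁ : K₁ ≤ K) (hM₀ : M₀ ≤ M)
    {X X₀ X₁ : Set E} {Y Y₀ : Set E'} (hX : X = i '' K.space) (hX₀ : X₀ = i '' K₀.space)
    (hX₁ : X₁ = i '' K₁.space) (hY : Y = j '' M.space) (hY₀ : Y₀ = j '' M₀.space)
    {f : cone X → cone Y}
    (hf : IsCoarsePairMap f (traceOn (cone X) (cone X₀))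
      (traceOn (cone Y) (cone Y₀))) {C : ℝ≥0}
    (hfC : LipschitzOnWith C f (traceOn (cone X) (cone X₁))) :
    ∃ (F : E × ℝ → E' × ℝ) (C' : ℝ≥0) (D : ℝ), LipschitzOnWith C' F (cone X) ∧
      Set.MapsTo F (cone X) (cone Y) ∧
      Set.MapsTo F (cone X₀) (cone Y₀) ∧
      (∀ z : cone X, (z : E × ℝ) ∈ cone X₁ → F z = f z) ∧
      ∀ z : cone X, dist (F z) (f z) ≤ D := by
  classical
  have hspace : ∀ {K' : Geometry.SimplicialComplex ℝ U}, K' ≤ K →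
      cone (i '' K'.space) ⊆ cone X := fun hle => by
    rw [hX]; exact cone_mono (Set.image_mono (Set.biUnion_subset_biUnion_left hle))
  have hA₀ : cone X₀ ⊆ cone X := by rw [hX₀]; exact hspace hK₀
  have hA₁ : cone X₁ ⊆ cone X := by rw [hX₁]; exact hspace hK₁
  have hspace' : cone Y₀ ⊆ cone Y := by
    rw [hY, hY₀]; exact cone_mono (Set.image_mono (Set.biUnion_subset_biUnion_left hM₀))
  obtain ⟨k, hk, hline⟩ := hi.exists_broken_line
  rw [← hX] at hline
  let φ : E × ℝ → E' × ℝ := fun z => if h : z ∈ cone X then f ⟨z, h⟩ else 0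
  have hφ : ∀ z : cone X, φ z = f z := fun z => dif_pos z.2
  have hφB : Set.MapsTo φ (cone X) (cone Y) := fun z hz => by rw [hφ ⟨z, hz⟩]; exact (f _).2
  have hφB₀ : Set.MapsTo φ (cone X₀) (cone Y₀) := fun z hz => by
    rw [hφ ⟨z, hA₀ hz⟩]
    exact hf.2 (show (⟨z, hA₀ hz⟩ : cone X) ∈ traceOn (cone X) (cone X₀) from hz)
  have hφC : LipschitzOnWith C φ (cone X₁) := LipschitzOnWith.of_dist_le_mul fun x hx y hy => by
    rw [hφ ⟨x, hA₁ hx⟩, hφ ⟨y, hA₁ hy⟩]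
    exact hfC.dist_le_mul ⟨x, hA₁ hx⟩ hx ⟨y, hA₁ hy⟩ hy
  obtain ⟨S, hS, hSf⟩ := hf.1.1 2 two_pos
  have hSφ : ∀ x ∈ cone X, ∀ y ∈ cone X, dist x y < 2 → dist (φ x) (φ y) ≤ S :=
    fun x hx y hy h => by
    rw [hφ ⟨x, hx⟩, hφ ⟨y, hy⟩]; exact (hSf ⟨x, hx⟩ ⟨y, hy⟩ h).le
  set c := 2 * S * k + 2 * S with hc
  have hc0 : 0 ≤ c := by positivity
  have hφc : ∀ x ∈ cone X, ∀ y ∈ cone X, dist (φ x) (φ y) ≤ c * dist x y + c := by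
    intro x hx y hy
    obtain ⟨z, hxz, hzy, h1, h2, -⟩ := hline x hx y hy
    calc dist (φ x) (φ y) ≤ dist (φ x) (φ z) + dist (φ z) (φ y) := dist_triangle _ _ _
      _ ≤ S * (dist x z + 1) + S * (dist z y + 1) :=
        add_le_add (dist_le_of_segment_subset hSφ hxz) (dist_le_of_segment_subset hSφ hzy)
      _ ≤ S * (k * dist x y + 1) + S * (k * dist x y + 1) := by gcongr
      _ ≤ c * dist x y + c := by
        have : 0 ≤ S * dist x y := by positivity
        have : 0 ≤ S * k := by positivity
        rw [hc]; nlinarith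
  obtain ⟨F₀, C₀, D₀, hF₀, hF₀B, hF₀eq, hF₀D⟩ := _root_.exists_lipschitz_approximation
    (Z := cone X₀) (B := cone X₀ ∩ cone X₁) Set.inter_subset_left
    (by rw [hY₀]; exact fun h => hj.exists_lipschitz_retraction hM₀ h) hφB₀ hc0
    (fun x hx y hy => hφc x (hA₀ hx) y (hA₀ hy)) (hφC.mono Set.inter_subset_right)
  let φ₁ : E × ℝ → E' × ℝ := fun z => if z ∈ cone X₀ then F₀ z else φ z
  have hφ₁A₀ : Set.EqOn φ₁ F₀ (cone X₀) := fun z hz => if_pos hz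
  have hφ₁A₁ : Set.EqOn φ₁ φ (cone X₁) := fun z hz => by
    by_cases h : z ∈ cone X₀
    · rw [hφ₁A₀ h, hF₀eq ⟨h, hz⟩]
    · exact if_neg h
  have hφ₁D : ∀ z, dist (φ₁ z) (φ z) ≤ max D₀ 0 := fun z => by
    by_cases h : z ∈ cone X₀
    · rw [hφ₁A₀ h]; exact (hF₀D z h).trans (le_max_left _ _)
    · rw [show φ₁ z = φ z from if_neg h, dist_self]; exact le_max_right _ _
  have hφ₁B : Set.MapsTo φ₁ (cone X) (cone Y) := fun z hz => by
    by_cases h : z ∈ cone X₀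
    · rw [hφ₁A₀ h]; exact hspace' (hF₀B h)
    · rw [show φ₁ z = φ z from if_neg h]; exact hφB hz
  have hφ₁c : ∀ x ∈ cone X, ∀ y ∈ cone X,
      dist (φ₁ x) (φ₁ y) ≤ (c + 2 * max D₀ 0) * dist x y + (c + 2 * max D₀ 0) := by
    intro x hx y hy
    have h1 := dist_triangle4 (φ₁ x) (φ x) (φ y) (φ₁ y)
    have h2 := hφ₁D x
    have h3 := hφ₁D y
    rw [dist_comm] at h3
    have h4 := hφc x hx y hy
    have h5 : 0 ≤ max D₀ 0 * dist x y := mul_nonneg (le_max_right _ _) dist_nonneg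
    linarith
  have hlip : LipschitzOnWith (max C₀ C + 2 * max C₀ C * k.toNNReal) φ₁ (cone X₀ ∪ cone X₁) := by
    refine LipschitzOnWith.union_of_broken_line ?_ ?_ fun a ha b hb => ?_
    · exact LipschitzOnWith.weaken (fun x hx y hy => by rw [hφ₁A₀ hx, hφ₁A₀ hy]; exact hF₀ hx hy)
        (le_max_left _ _)
    · exact LipschitzOnWith.weaken (fun x hx y hy => by rw [hφ₁A₁ hx, hφ₁A₁ hy]; exact hφC hx hy)
        (le_max_right _ _)
    · obtain ⟨z, -, -, h1, h2, h3⟩ := hline a (hA₀ ha) b (hA₁ hb)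
      rw [Real.coe_toNNReal _ hk.le]
      exact ⟨z, ⟨hX₀ ▸ h3 K₀ hK₀ (Or.inl (hX₀ ▸ ha)),
        hX₁ ▸ h3 K₁ hK₁ (Or.inr (hX₁ ▸ hb))⟩, h1, h2⟩
  obtain ⟨F, C', D, hF, hFB, hFeq, hFD⟩ := _root_.exists_lipschitz_approximation
    (Z := cone X) (B := cone X₀ ∪ cone X₁) (Set.union_subset hA₀ hA₁)
    (by rw [hY]; exact fun h => hj.exists_lipschitz_retraction le_rfl h) hφ₁B
    (add_nonneg hc0 (mul_nonneg two_pos.le (le_max_right _ _))) hφ₁c hlip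
  refine ⟨F, C', D + max D₀ 0, hF, hFB, fun z hz => ?_, fun z hz => ?_, fun z => ?_⟩
  · rw [hFeq (Or.inl hz), hφ₁A₀ hz]; exact hF₀B hz
  · rw [hFeq (Or.inr hz), hφ₁A₁ hz, hφ z]
  · rw [← hφ z]
    exact (dist_triangle _ (φ₁ z) _).trans (add_le_add (hFD z z.2) (hφ₁D z))

end Approximation

/-! ### Normalizing heights at the bottom of a cone -/

section HeightNormalization

variable {E E' : Type*} [NormedAddCommGroup E] [NormedAddCommGroup E'] [NormedSpace ℝ E']

/-- Rescaling a Lipschitz map `F` between cones so that it preserves the height at level `L`. The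
height `s` of `F z` is replaced by its projection `s'` to an interval around the height `h` of `z`
which is a point at `h = L`, and which contains `s` as soon as `h ≥ 2 L`. -/
theorem exists_height_normalization {A : Set (E × ℝ)} {F : E × ℝ → E' × ℝ} {C : ℝ≥0}
    {R c₀ L : ℝ} (hL : 0 < L) (hc₀ : 0 ≤ c₀) (hF : LipschitzOnWith C F A)
    (hR : ∀ z ∈ A, ‖F z‖ ≤ R * (F z).2) (hpos : ∀ z ∈ A, L ≤ z.2 → 1 ≤ (F z).2)
    (hgrowth : ∀ z ∈ A, L ≤ z.2 → (F z).2 ≤ c₀ * z.2) :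
    ∃ (κ : E × ℝ → ℝ) (C' : ℝ≥0) (D : ℝ),
      LipschitzOnWith C' (fun z => κ z • F z) {z ∈ A | L ≤ z.2} ∧
      ∀ z ∈ A, L ≤ z.2 → 0 < κ z ∧ dist (κ z • F z) (F z) ≤ D ∧ ((F z).2 = z.2 → κ z = 1) ∧
        (z.2 = L → κ z * (F z).2 = L) ∧ min (F z).2 z.2 ≤ κ z * (F z).2 := by
  rcases (A ∩ {z | L ≤ z.2}).eq_empty_or_nonempty with he | ⟨z₀, hz₀, hz₀L⟩
  · refine ⟨fun _ => 1, C, 0, ?_, fun z hz hzL => ?_⟩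
    · simp only [one_smul]; exact hF.mono fun z hz => hz.1
    · exact absurd (show z ∈ A ∩ {z | L ≤ z.2} from ⟨hz, hzL⟩) (by rw [he]; simp)
  have hR0 : 0 ≤ R := by
    have h1 := hR z₀ hz₀
    have h2 := hpos z₀ hz₀ hz₀L
    by_contra! h
    have := norm_nonneg (F z₀)
    nlinarith
  clear hz₀ hz₀L z₀
  let β : E × ℝ → ℝ := fun z => 2 * (c₀ + 1) * (z.2 - L)
  let s' : E × ℝ → ℝ := fun z => max (z.2 - β z) (min (F z).2 (z.2 + β z))
  let η : E × ℝ → ℝ := fun z => s' z - (F z).2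
  have hβ : ∀ z : E × ℝ, L ≤ z.2 → 0 ≤ β z := fun z hz =>
    mul_nonneg (by positivity) (sub_nonneg.2 hz)
  have hmin : ∀ z : E × ℝ, L ≤ z.2 → min (F z).2 z.2 ≤ s' z := fun z hz =>
    (min_le_min le_rfl (by linarith [hβ z hz])).trans (le_max_right _ _)
  set D := 2 * (c₀ + 1) * L
  have hη : ∀ z ∈ A, L ≤ z.2 → |η z| ≤ D := by
    intro z hz hzL
    have h1 := hpos z hz hzL
    have h2 := hgrowth z hz hzL
    have hb := hβ z hzL
    have hD : 0 ≤ D := by positivity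
    rcases le_total (2 * L) z.2 with h | h
    · have h3 : c₀ * z.2 + z.2 ≤ β z := by
        have : β z - (c₀ * z.2 + z.2) = (c₀ + 1) * (z.2 - 2 * L) := by simp only [β]; ring
        have : 0 ≤ (c₀ + 1) * (z.2 - 2 * L) := mul_nonneg (by positivity) (by linarith)
        linarith
      have h4 : η z = 0 := by
        have h5 : 0 ≤ c₀ * z.2 := mul_nonneg hc₀ (by linarith)
        simp only [η, s']
        rw [min_eq_left (by linarith), max_eq_right (by linarith), sub_self]
      rw [h4, abs_zero]; exact hD
    · have h3 : c₀ * z.2 + z.2 ≤ D := by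
        have : D - (c₀ * z.2 + z.2) = (c₀ + 1) * (2 * L - z.2) := by simp only [D]; ring
        have : 0 ≤ (c₀ + 1) * (2 * L - z.2) := mul_nonneg (by positivity) (by linarith)
        linarith
      have h5 : 0 ≤ c₀ * z.2 := mul_nonneg hc₀ (by linarith)
      rw [abs_le]
      simp only [η, s']
      constructor
      · rcases le_total (F z).2 (z.2 + β z) with h6 | h6
        · have := le_max_right (z.2 - β z) (min (F z).2 (z.2 + β z))
          rw [min_eq_left h6] at this ⊢
          linarith
        · have := le_max_right (z.2 - β z) (min (F z).2 (z.2 + β z))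
          rw [min_eq_right h6] at this ⊢
          linarith
      · have h7 := min_le_left (F z).2 (z.2 + β z)
        have := max_le (a := z.2 - β z) (b := min (F z).2 (z.2 + β z)) (c := (F z).2 + D)
          (by linarith) (by linarith)
        linarith
  have hsnd : ∀ p q : E × ℝ, |p.2 - q.2| ≤ dist p q := fun p q => le_max_right _ _
  have hsnd' : ∀ p ∈ A, ∀ q ∈ A, |(F p).2 - (F q).2| ≤ C * dist p q := fun p hp q hq =>
    (le_max_right _ _).trans (hF.dist_le_mul p hp q hq)
  set c₁ := 2 * (c₀ + 1)
  have hc₁ : 0 ≤ c₁ := by positivity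
  have hβd : ∀ p q : E × ℝ, |β p - β q| ≤ c₁ * dist p q := fun p q => by
    have : β p - β q = c₁ * (p.2 - q.2) := by simp only [β]; ring
    rw [this, abs_mul, abs_of_nonneg hc₁]
    exact mul_le_mul_of_nonneg_left (hsnd p q) hc₁
  have hηd : ∀ p ∈ A, ∀ q ∈ A, |η p - η q| ≤ (1 + c₁ + C + C) * dist p q := by
    intro p hp q hq
    have h1 := hsnd p q
    have h2 := hsnd' p hp q hq
    have h3 := hβd p q
    have hd : 0 ≤ dist p q := dist_nonneg
    have hCd : 0 ≤ C * dist p q := by positivity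
    have hcd : 0 ≤ c₁ * dist p q := by positivity
    have h4 : |s' p - s' q| ≤ (1 + c₁ + C) * dist p q := by
      refine (abs_max_sub_max_le_max _ _ _ _).trans (max_le ?_ ?_)
      · rw [abs_le] at h1 h3 ⊢
        constructor <;> linarith
      · refine (abs_min_sub_min_le_max _ _ _ _).trans (max_le (by linarith) ?_)
        rw [abs_le] at h1 h3 ⊢
        constructor <;> linarith
    simp only [η]
    rw [abs_le] at h2 h4 ⊢
    constructor <;> linarith
  have hκ : ∀ z ∈ A, L ≤ z.2 → (s' z / (F z).2) • F z = F z + η z • ((F z).2⁻¹ • F z) := by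
    intro z hz hzL
    have h1 := hpos z hz hzL
    have h0 : (F z).2 ≠ 0 := by linarith
    have h2 : s' z / (F z).2 = 1 + η z * (F z).2⁻¹ := by simp only [η]; field_simp; ring
    rw [h2, add_smul, one_smul, mul_smul]
  have hdir : ∀ z ∈ A, L ≤ z.2 → ‖(F z).2⁻¹ • F z‖ ≤ R := by
    intro z hz hzL
    have h1 := hpos z hz hzL
    rw [norm_smul, norm_inv, Real.norm_of_nonneg (by linarith), inv_mul_eq_div,
      div_le_iff₀ (by linarith)]
    exact hR z hz
  have hdird : ∀ p ∈ A, L ≤ p.2 → ∀ q ∈ A, L ≤ q.2 →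
      ‖(F p).2⁻¹ • F p - (F q).2⁻¹ • F q‖ ≤ (C + R * C) * dist p q := by
    intro p hp hpL q hq hqL
    have h1 := hpos p hp hpL
    have h2 := hpos q hq hqL
    have h3 : (F p).2⁻¹ • F p - (F q).2⁻¹ • F q =
        (F p).2⁻¹ • ((F p - F q) + ((F q).2 - (F p).2) • ((F q).2⁻¹ • F q)) := by
      have e1 : (F p).2 ≠ 0 := by linarith
      have e2 : (F q).2 ≠ 0 := by linarith
      rw [smul_smul, smul_add, smul_sub, smul_smul, sub_add, ← sub_smul]
      congr 2
      field_simp; ring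
    rw [h3, norm_smul, norm_inv, Real.norm_of_nonneg (by linarith)]
    have h4 : ‖F p - F q‖ ≤ C * dist p q := by rw [← dist_eq_norm]; exact hF.dist_le_mul p hp q hq
    have h5 : ‖((F q).2 - (F p).2) • ((F q).2⁻¹ • F q)‖ ≤ C * dist p q * R := by
      rw [norm_smul, Real.norm_eq_abs, abs_sub_comm]
      exact mul_le_mul (hsnd' p hp q hq) (hdir q hq hqL) (norm_nonneg _) (by positivity)
    calc (F p).2⁻¹ * ‖F p - F q + ((F q).2 - (F p).2) • ((F q).2⁻¹ • F q)‖
        ≤ 1 * ‖F p - F q + ((F q).2 - (F p).2) • ((F q).2⁻¹ • F q)‖ := by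
          gcongr; exact inv_le_one_of_one_le₀ h1
      _ ≤ C * dist p q + C * dist p q * R := by
        rw [one_mul]; exact (norm_add_le _ _).trans (add_le_add h4 h5)
      _ = _ := by ring
  refine ⟨fun z => s' z / (F z).2, C + ((1 + c₁ + C + C) * R + D * (C + R * C)).toNNReal, D * R,
    LipschitzOnWith.of_dist_le_mul ?_, fun z hz hzL => ?_⟩
  · rintro p ⟨hp, hpL⟩ q ⟨hq, hqL⟩
    dsimp only
    rw [hκ p hp hpL, hκ q hq hqL, dist_eq_norm]
    have h1 : F p + η p • ((F p).2⁻¹ • F p) - (F q + η q • ((F q).2⁻¹ • F q)) =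
        (F p - F q) + ((η p - η q) • ((F p).2⁻¹ • F p) +
          η q • ((F p).2⁻¹ • F p - (F q).2⁻¹ • F q)) := by
      rw [sub_smul (η p), smul_sub (η q)]; abel
    have hD : 0 ≤ D := by positivity
    rw [h1]
    have h2 : ‖F p - F q‖ ≤ C * dist p q := by rw [← dist_eq_norm]; exact hF.dist_le_mul p hp q hq
    have h3 : ‖(η p - η q) • ((F p).2⁻¹ • F p)‖ ≤ (1 + c₁ + C + C) * dist p q * R := by
      rw [norm_smul]
      exact mul_le_mul (hηd p hp q hq) (hdir p hp hpL) (norm_nonneg _) (by positivity)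
    have h4 : ‖η q • ((F p).2⁻¹ • F p - (F q).2⁻¹ • F q)‖ ≤ D * ((C + R * C) * dist p q) := by
      rw [norm_smul]
      exact mul_le_mul (hη q hq hqL) (hdird p hp hpL q hq hqL) (norm_nonneg _) hD
    push_cast
    rw [Real.coe_toNNReal _ (by positivity)]
    calc _ ≤ _ := (norm_add_le _ _).trans (add_le_add h2 ((norm_add_le _ _).trans
          (add_le_add h3 h4)))
      _ = _ := by ring
  · have h1 := hpos z hz hzL
    have h0 : (F z).2 ≠ 0 := by linarith
    have hs : s' z / (F z).2 * (F z).2 = s' z := div_mul_cancel₀ _ h0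
    have hspos : 0 < s' z := lt_of_lt_of_le (lt_min (by linarith) (by linarith)) (hmin z hzL)
    refine ⟨div_pos hspos (by linarith), ?_, fun h => ?_, fun h => ?_, ?_⟩
    · dsimp only
      rw [hκ z hz hzL, dist_eq_norm, add_sub_cancel_left, norm_smul]
      exact mul_le_mul (hη z hz hzL) (hdir z hz hzL) (norm_nonneg _) (by positivity)
    · have hb := hβ z hzL
      have : s' z = (F z).2 := by
        simp only [s']
        rw [min_eq_left (by linarith), max_eq_right (by linarith)]
      dsimp only
      rw [this, div_self h0]
    · rw [hs]
      have hb : β z = 0 := by simp [β, h]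
      simp only [s']
      rw [hb, sub_zero, add_zero, h]
      exact max_eq_left (min_le_right _ _)
    · rw [hs]; exact hmin z hzL

end HeightNormalization

/-! ### The contraction to a radial map -/

section RadialHomotopy

/-- The height `max (h - t) √(L h)`: it decreases from `h` to `√(L h)` with unit speed and stays
there. -/
noncomputable def descent (L h t : ℝ) : ℝ := max (h - t) √(L * h)

/-- The factor `max (t - h) √(L h) / √(L h)`: it is `1` while the height descends, and then grows
from `1` to `√(h / L)`. -/
noncomputable def dilation (L h t : ℝ) : ℝ := max (t - h) √(L * h) / √(L * h)

variable {L h t h' t' d : ℝ}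

theorem le_sqrt_mul (hL : 0 < L) (hh : L ≤ h) : L ≤ √(L * h) :=
  Real.le_sqrt_of_sq_le (by nlinarith)

theorem sqrt_mul_le (hL : 0 < L) (hh : L ≤ h) : √(L * h) ≤ h :=
  Real.sqrt_le_iff.2 ⟨by linarith, by nlinarith⟩

theorem sqrt_mul_pos (hL : 0 < L) (hh : L ≤ h) : 0 < √(L * h) :=
  Real.sqrt_pos.2 (mul_pos hL (hL.trans_le hh))

theorem sq_sqrt_mul (hL : 0 < L) (hh : L ≤ h) : √(L * h) * √(L * h) = L * h :=
  Real.mul_self_sqrt (mul_nonneg hL.le (hL.le.trans hh))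

theorem one_le_dilation (hL : 0 < L) (hh : L ≤ h) : 1 ≤ dilation L h t :=
  (one_le_div (sqrt_mul_pos hL hh)).2 (le_max_right _ _)

theorem dilation_mul (hL : 0 < L) (hh : L ≤ h) :
    dilation L h t * √(L * h) = max (t - h) √(L * h) :=
  div_mul_cancel₀ _ (sqrt_mul_pos hL hh).ne'

theorem dilation_mul_le (hL : 0 < L) (hh : L ≤ h) (ht : t ≤ 2 * h) :
    dilation L h t * √(L * h) ≤ h := by
  rw [dilation_mul hL hh]; exact max_le (by linarith) (sqrt_mul_le hL hh)

theorem dilation_eq_one (hL : 0 < L) (hh : L ≤ h) (ht : t ≤ h) : dilation L h t = 1 := by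
  have := sqrt_mul_pos hL hh
  rw [dilation, max_eq_right (by linarith), div_self this.ne']

theorem descent_eq_sqrt (ht : h ≤ t) : descent L h t = √(L * h) :=
  max_eq_right (by have := Real.sqrt_nonneg (L * h); linarith)

theorem descent_pos (hL : 0 < L) (hh : L ≤ h) : 0 < descent L h t :=
  (sqrt_mul_pos hL hh).trans_le (le_max_right _ _)

theorem descent_le (hL : 0 < L) (hh : L ≤ h) (ht : 0 ≤ t) : descent L h t ≤ h :=
  max_le (by linarith) (sqrt_mul_le hL hh)

theorem dilation_mul_descent_le (hL : 0 < L) (hh : L ≤ h) (ht₀ : 0 ≤ t) (ht : t ≤ 2 * h) :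
    dilation L h t * descent L h t ≤ h := by
  rcases le_total t h with hth | hth
  · rw [dilation_eq_one hL hh hth, one_mul]; exact descent_le hL hh ht₀
  · rw [descent_eq_sqrt hth]; exact dilation_mul_le hL hh ht

theorem le_descent_div_dilation (hL : 0 < L) (hh : L ≤ h) (ht : t ≤ 2 * h) :
    L ≤ descent L h t / dilation L h t := by
  rcases le_total t h with hth | hth
  · rw [dilation_eq_one hL hh hth, div_one]
    exact (le_sqrt_mul hL hh).trans (le_max_right _ _)
  · have h1 := dilation_mul_le hL hh ht
    have h2 := one_le_dilation hL hh (t := t)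
    rw [descent_eq_sqrt hth, le_div_iff₀ (by linarith)]
    have h3 := sqrt_mul_pos hL hh
    have h4 := sq_sqrt_mul hL hh
    refine le_of_mul_le_mul_right ?_ h3
    rw [h4, mul_assoc]
    exact mul_le_mul_of_nonneg_left h1 hL.le

theorem dilation_mul_abs_sqrt_sub_le (hL : 0 < L) (hh : L ≤ h) (ht : t ≤ 2 * h)
    (hhd : |h - h'| ≤ d) (hh' : L ≤ h') :
    dilation L h t * |√(L * h) - √(L * h')| ≤ d := by
  have h1 := dilation_mul_le hL hh ht
  have h2 := sqrt_mul_pos hL hh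
  have h2' := sqrt_mul_pos hL hh'
  have h3 := sq_sqrt_mul hL hh
  have h3' := sq_sqrt_mul hL hh'
  have h4 : |√(L * h) - √(L * h')| * √(L * h) ≤ L * d := by
    calc |√(L * h) - √(L * h')| * √(L * h)
        ≤ |√(L * h) - √(L * h')| * |√(L * h) + √(L * h')| := by
          gcongr; rw [abs_of_pos (by positivity)]; linarith
      _ = L * |h - h'| := by
        rw [← abs_mul, ← abs_of_pos hL, ← abs_mul, abs_of_pos hL]; congr 1; nlinarith
      _ ≤ L * d := by gcongr
  have h5 : 0 ≤ dilation L h t := zero_le_one.trans (one_le_dilation hL hh)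
  refine le_of_mul_le_mul_right ?_ (mul_pos h2 h2)
  calc dilation L h t * |√(L * h) - √(L * h')| * (√(L * h) * √(L * h))
      = (dilation L h t * √(L * h)) * (|√(L * h) - √(L * h')| * √(L * h)) := by ring
    _ ≤ h * (L * d) := mul_le_mul h1 h4 (by positivity) (by linarith)
    _ = d * (√(L * h) * √(L * h)) := by rw [h3]; ring

theorem lt_of_one_lt_dilation (hL : 0 < L) (hh : L ≤ h) (hk : 1 < dilation L h t) : h < t := by
  by_contra! hth
  rw [dilation_eq_one hL hh hth] at hk
  exact lt_irrefl _ hk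

theorem dilation_mul_abs_descent_sub_le (hL : 0 < L) (hh : L ≤ h) (hh' : L ≤ h')
    (ht : t ≤ 2 * h) (hhd : |h - h'| ≤ d) (htd : |t - t'| ≤ d)
    (hk : dilation L h t ≤ dilation L h' t') :
    dilation L h t * |descent L h t - descent L h' t'| ≤ 2 * d := by
  have hd : 0 ≤ d := (abs_nonneg _).trans hhd
  have h1 := dilation_mul_abs_sqrt_sub_le hL hh ht hhd hh'
  rcases (one_le_dilation hL hh (t := t)).eq_or_lt with hk1 | hk1
  · rw [← hk1, one_mul] at h1 ⊢
    refine (abs_max_sub_max_le_max _ _ _ _).trans (max_le ?_ (by linarith))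
    rw [abs_le] at hhd htd ⊢
    constructor <;> linarith
  · rw [descent_eq_sqrt (lt_of_one_lt_dilation hL hh hk1).le,
      descent_eq_sqrt (lt_of_one_lt_dilation hL hh' (hk1.trans_le hk)).le]
    linarith

theorem descent_mul_dilation_sub_le (hL : 0 < L) (hh : L ≤ h) (hh' : L ≤ h')
    (ht : t ≤ 2 * h) (hhd : |h - h'| ≤ d) (htd : |t - t'| ≤ d)
    (hk : dilation L h t ≤ dilation L h' t') :
    descent L h' t' * (dilation L h' t' - dilation L h t) ≤ 4 * d := by
  have hd : 0 ≤ d := (abs_nonneg _).trans hhd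
  have h1 := dilation_mul_abs_sqrt_sub_le hL hh ht hhd hh'
  rcases (one_le_dilation hL hh' (t := t')).eq_or_lt with hk1 | hk1
  · have : dilation L h t = 1 := le_antisymm (hk1 ▸ hk) (one_le_dilation hL hh)
    rw [this, ← hk1, sub_self, mul_zero]; linarith
  · rw [descent_eq_sqrt (lt_of_one_lt_dilation hL hh' hk1).le, mul_sub, mul_comm,
      dilation_mul hL hh']
    have h2 := dilation_mul hL hh (t := t)
    have h0 := one_le_dilation hL hh (t := t)
    have h3 : |√(L * h) - √(L * h')| ≤ d :=
      (le_mul_of_one_le_left (abs_nonneg _) h0).trans h1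
    have h4 : |max (t' - h') √(L * h') - max (t - h) √(L * h)| ≤ 2 * d := by
      refine (abs_max_sub_max_le_max _ _ _ _).trans (max_le ?_ ?_)
      · rw [abs_le] at hhd htd ⊢
        constructor <;> linarith
      · rw [abs_sub_comm]; linarith
    have h5 : dilation L h t * (√(L * h) - √(L * h')) ≤ d :=
      (mul_le_mul_of_nonneg_left (le_abs_self _) (by linarith)).trans h1
    have h6 := le_of_abs_le h4
    nlinarith

variable {E E' : Type*} [NormedAddCommGroup E] [NormedSpace ℝ E] [NormedAddCommGroup E']
  [NormedSpace ℝ E']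

/-- The homotopy from `F` to the radial extension of its restriction to level `L`. Over a point of
height `h`, it evaluates `F` at the height `y = descent / dilation`, which decreases from `h` to
`√(L h)` and then, inversely proportionally to `t - h`, to `L`; the value is multiplied by
`dilation ^ 2`, which is `√(L h) / y` times `dilation` during the second phase and ends at `h / L`.
The intermediate level `√(L h)` makes the logarithmic speed of `y` in the second phase the
opposite of that of `dilation`, so that the rescaled map is Lipschitz. -/
noncomputable def radialHomotopy (F : E × ℝ → E' × ℝ) (L : ℝ) (z : E × ℝ) (t : ℝ) : E' × ℝ :=
  dilation L z.2 t ^ 2 • F ((descent L z.2 t / dilation L z.2 t / z.2) • z)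

theorem radialHomotopy_zero (F : E × ℝ → E' × ℝ) (hL : 0 < L) {z : E × ℝ} (hz : L ≤ z.2) :
    radialHomotopy F L z 0 = F z := by
  have h0 : z.2 ≠ 0 := (hL.trans_le hz).ne'
  rw [radialHomotopy, dilation_eq_one hL hz (hL.le.trans hz), descent,
    max_eq_left (by rw [sub_zero]; exact sqrt_mul_le hL hz), sub_zero, div_one, div_self h0,
    one_smul, one_pow, one_smul]

theorem radialHomotopy_two_mul (F : E × ℝ → E' × ℝ) (hL : 0 < L) {z : E × ℝ} (hz : L ≤ z.2) :
    radialHomotopy F L z (2 * z.2) = (z.2 / L) • F ((L / z.2) • z) := by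
  have hh : 0 < z.2 := hL.trans_le hz
  have h1 := sqrt_mul_pos hL hz
  have h2 := sq_sqrt_mul hL hz
  have hk : dilation L z.2 (2 * z.2) = z.2 / √(L * z.2) := by
    rw [dilation, max_eq_left]
    · congr 1; ring
    · have := sqrt_mul_le hL hz; linarith
  rw [radialHomotopy, hk, descent_eq_sqrt (by linarith)]
  congr 2
  · rw [div_pow, sq (√(L * z.2)), h2]; field_simp
  · rw [div_div_eq_mul_div, h2]; field_simp

/-- Where `F` is radial, the homotopy rescales `F`, symmetrically in the two phases. -/
theorem radialHomotopy_of_radial {F : E × ℝ → E' × ℝ} (hL : 0 < L) {z : E × ℝ} (hz : L ≤ z.2)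
    (ht : t ≤ 2 * z.2) (hF : ∀ r : ℝ, 0 ≤ r → L ≤ r * z.2 → F (r • z) = r • F z) :
    radialHomotopy F L z t =
      (max (z.2 - t) √(L * z.2) * max (t - z.2) √(L * z.2) / (√(L * z.2) * z.2)) • F z := by
  have hh : 0 < z.2 := hL.trans_le hz
  have h1 := sqrt_mul_pos hL hz
  have hk := one_le_dilation hL hz (t := t)
  have hr := le_descent_div_dilation hL hz ht
  rw [radialHomotopy, hF _ (div_nonneg (hL.le.trans hr) hh.le) (by rwa [div_mul_cancel₀ _ hh.ne']),
    smul_smul, ← dilation_mul hL hz, descent]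
  congr 1
  field_simp

theorem radialHomotopy_mem {F : E × ℝ → E' × ℝ} {X : Set E} {Y : Set E'} (hL : 0 < L)
    (hF : Set.MapsTo F (coneAbove L X) (cone Y)) {z : E × ℝ} (hz : z ∈ coneAbove L X)
    (ht : t ≤ 2 * z.2) : radialHomotopy F L z t ∈ cone Y := by
  have hr := le_descent_div_dilation hL hz.2 ht
  have hh : 0 < z.2 := hL.trans_le hz.2
  refine smul_mem_cone (hF ⟨smul_mem_cone hz.1 (div_nonneg (hL.le.trans hr) hh.le), ?_⟩)
    (sq_nonneg _)
  rw [Prod.smul_snd, smul_eq_mul, div_mul_cancel₀ _ hh.ne']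
  exact hr

/-- The homotopy is Lipschitz. -/
theorem exists_dist_radialHomotopy_le {F : E × ℝ → E' × ℝ} {X : Set E} {C : ℝ≥0} {R c₀ : ℝ}
    (hL : 0 < L) (hF : LipschitzOnWith C F (coneAbove L X)) (hR0 : 0 ≤ R)
    (hR : ∀ z ∈ cone X, ‖z‖ ≤ R * z.2) (hc₀ : 0 ≤ c₀)
    (hgrowth : ∀ z ∈ coneAbove L X, ‖F z‖ ≤ c₀ * z.2) :
    ∃ c : ℝ, 0 ≤ c ∧ ∀ z ∈ coneAbove L X, ∀ z' ∈ coneAbove L X, ∀ t t' d : ℝ, 0 ≤ t → 0 ≤ t' →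
      t ≤ 2 * z.2 → t' ≤ 2 * z'.2 → dist z z' ≤ d → |t - t'| ≤ d →
      dist (radialHomotopy F L z t) (radialHomotopy F L z' t') ≤ c * d := by
  refine ⟨C * ((1 + R) + 6 * R) + 8 * c₀, by positivity, ?_⟩
  -- by symmetry, the dilation factor at `(z, t)` may be assumed to be the smaller one
  have key : ∀ z ∈ coneAbove L X, ∀ z' ∈ coneAbove L X, ∀ t t' d : ℝ, 0 ≤ t → 0 ≤ t' →
      t ≤ 2 * z.2 → t' ≤ 2 * z'.2 → dist z z' ≤ d → |t - t'| ≤ d →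
      dilation L z.2 t ≤ dilation L z'.2 t' →
      dist (radialHomotopy F L z t) (radialHomotopy F L z' t') ≤
        (C * ((1 + R) + 6 * R) + 8 * c₀) * d := by
    intro z hz z' hz' t t' d ht0 ht0' ht ht' hzd htd hk
    have hhd : |z.2 - z'.2| ≤ d := (le_max_right _ _).trans hzd
    have I := dilation_mul_abs_descent_sub_le hL hz.2 hz'.2 ht hhd htd hk
    have II := descent_mul_dilation_sub_le hL hz.2 hz'.2 ht hhd htd hk
    have hk1 := one_le_dilation hL hz.2 (t := t)
    have hk1' := one_le_dilation hL hz'.2 (t := t')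
    have hkr := dilation_mul_descent_le hL hz.2 ht0 ht
    have hy := le_descent_div_dilation hL hz.2 ht
    have hy' := le_descent_div_dilation hL hz'.2 ht'
    have hr' := descent_pos hL hz'.2 (t := t')
    have hr := descent_pos hL hz.2 (t := t)
    have hmem : ∀ z ∈ coneAbove L X, ∀ y : ℝ, L ≤ y → (y / z.2) • z ∈ coneAbove L X := by
      intro z hz y hy
      have hh : 0 < z.2 := hL.trans_le hz.2
      refine ⟨smul_mem_cone hz.1 (div_nonneg (hL.le.trans hy) hh.le), ?_⟩
      rwa [Prod.smul_snd, smul_eq_mul, div_mul_cancel₀ _ hh.ne']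
    have hm := hmem z hz _ hy
    have hm' := hmem z' hz' _ hy'
    unfold radialHomotopy
    set k := dilation L z.2 t
    set k' := dilation L z'.2 t'
    set r := descent L z.2 t
    set r' := descent L z'.2 t'
    have hh : 0 < z.2 := hL.trans_le hz.2
    have hh' : 0 < z'.2 := hL.trans_le hz'.2
    have hd : 0 ≤ d := dist_nonneg.trans hzd
    have hk0 : 0 < k := by linarith
    have hk0' : 0 < k' := by linarith
    have hF' : ‖F ((r' / k' / z'.2) • z')‖ ≤ c₀ * (r' / k') := by
      refine (hgrowth _ hm').trans_eq ?_
      rw [Prod.smul_snd, smul_eq_mul, div_mul_cancel₀ _ hh'.ne']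
    have hunit : ‖z'.2⁻¹ • z'‖ ≤ R := by
      rw [norm_smul, norm_inv, Real.norm_of_nonneg hh'.le, inv_mul_eq_div, div_le_iff₀ hh']
      exact hR z' hz'.1
    have hdir : z.2 * ‖z.2⁻¹ • z - z'.2⁻¹ • z'‖ ≤ (1 + R) * d := by
      have e : z.2 • (z.2⁻¹ • z - z'.2⁻¹ • z') = (z - z') + (z'.2 - z.2) • z'.2⁻¹ • z' := by
        rw [smul_sub, smul_inv_smul₀ hh.ne', sub_smul, smul_inv_smul₀ hh'.ne']; abel
      calc z.2 * ‖z.2⁻¹ • z - z'.2⁻¹ • z'‖ = ‖(z - z') + (z'.2 - z.2) • z'.2⁻¹ • z'‖ := by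
            rw [← e, norm_smul, Real.norm_of_nonneg hh.le]
        _ ≤ ‖z - z'‖ + ‖(z'.2 - z.2) • z'.2⁻¹ • z'‖ := norm_add_le _ _
        _ ≤ d + d * R := by
          rw [norm_smul, ← dist_eq_norm, Real.norm_eq_abs, abs_sub_comm]
          exact add_le_add hzd (mul_le_mul hhd hunit (norm_nonneg _) hd)
        _ = _ := by ring
    have hlev : k ^ 2 * |r / k - r' / k'| ≤ 6 * d := by
      have e : k ^ 2 * (r / k - r' / k') = k * (r - r') + k / k' * (r' * (k' - k)) := by
        field_simp; ring
      have h1 : 0 ≤ r' * (k' - k) := mul_nonneg hr'.le (by linarith)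
      have h2 : k / k' ≤ 1 := (div_le_one hk0').2 hk
      calc k ^ 2 * |r / k - r' / k'| = |k * (r - r') + k / k' * (r' * (k' - k))| := by
            rw [← e, abs_mul, abs_of_nonneg (sq_nonneg k)]
        _ ≤ |k * (r - r')| + |k / k' * (r' * (k' - k))| := abs_add_le _ _
        _ = k * |r - r'| + k / k' * (r' * (k' - k)) := by
          rw [abs_mul, abs_of_pos hk0, abs_of_nonneg (mul_nonneg (by positivity) h1)]
        _ ≤ 2 * d + 1 * (4 * d) := add_le_add I (mul_le_mul h2 II h1 zero_le_one)
        _ = _ := by ring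
    have harg : k ^ 2 * dist ((r / k / z.2) • z) ((r' / k' / z'.2) • z') ≤
        (1 + R) * d + 6 * d * R := by
      have e : (r / k / z.2) • z - (r' / k' / z'.2) • z' =
          (r / k) • (z.2⁻¹ • z - z'.2⁻¹ • z') + (r / k - r' / k') • z'.2⁻¹ • z' := by
        rw [smul_sub, sub_smul, smul_smul, smul_smul, smul_smul]
        simp only [← div_eq_mul_inv]; abel
      calc k ^ 2 * dist ((r / k / z.2) • z) ((r' / k' / z'.2) • z')
          ≤ k ^ 2 * (r / k * ‖z.2⁻¹ • z - z'.2⁻¹ • z'‖ + |r / k - r' / k'| * R) := by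
            rw [dist_eq_norm, e]
            refine mul_le_mul_of_nonneg_left ((norm_add_le _ _).trans (add_le_add ?_ ?_))
              (by positivity)
            · rw [norm_smul, Real.norm_of_nonneg (by positivity)]
            · rw [norm_smul, Real.norm_eq_abs]
              exact mul_le_mul_of_nonneg_left hunit (abs_nonneg _)
        _ = k * r * ‖z.2⁻¹ • z - z'.2⁻¹ • z'‖ + k ^ 2 * |r / k - r' / k'| * R := by
          field_simp
        _ ≤ z.2 * ‖z.2⁻¹ • z - z'.2⁻¹ • z'‖ + 6 * d * R := by gcongr
        _ ≤ _ := by gcongr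
    have hfac : |k ^ 2 - k' ^ 2| * ‖F ((r' / k' / z'.2) • z')‖ ≤ 8 * c₀ * d := by
      have e : |k ^ 2 - k' ^ 2| = (k' - k) * (k' + k) := by
        rw [abs_sub_comm, abs_of_nonneg] <;> nlinarith
      calc |k ^ 2 - k' ^ 2| * ‖F ((r' / k' / z'.2) • z')‖
          ≤ (k' - k) * (2 * k') * (c₀ * (r' / k')) := by
            rw [e]
            have : 0 ≤ k' - k := by linarith
            gcongr
            linarith
        _ = 2 * c₀ * (r' * (k' - k)) := by field_simp
        _ ≤ 2 * c₀ * (4 * d) := by gcongr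
        _ = _ := by ring
    calc dist (k ^ 2 • F ((r / k / z.2) • z)) (k' ^ 2 • F ((r' / k' / z'.2) • z'))
        = ‖k ^ 2 • (F ((r / k / z.2) • z) - F ((r' / k' / z'.2) • z')) +
            (k ^ 2 - k' ^ 2) • F ((r' / k' / z'.2) • z')‖ := by
          rw [dist_eq_norm, smul_sub, sub_smul]; congr 1; abel
      _ ≤ k ^ 2 * (C * dist ((r / k / z.2) • z) ((r' / k' / z'.2) • z')) + 8 * c₀ * d := by
        refine (norm_add_le _ _).trans (add_le_add ?_ ?_)
        · rw [norm_smul, Real.norm_of_nonneg (by positivity), ← dist_eq_norm]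
          exact mul_le_mul_of_nonneg_left (hF.dist_le_mul _ hm _ hm') (by positivity)
        · rw [norm_smul, Real.norm_eq_abs]; exact hfac
      _ = C * (k ^ 2 * dist ((r / k / z.2) • z) ((r' / k' / z'.2) • z')) + 8 * c₀ * d := by ring
      _ ≤ C * ((1 + R) * d + 6 * d * R) + 8 * c₀ * d := by gcongr
      _ = _ := by ring
  intro z hz z' hz' t t' d ht0 ht0' ht ht' hzd htd
  rcases le_total (dilation L z.2 t) (dilation L z'.2 t') with hk | hk
  · exact key z hz z' hz' t t' d ht0 ht0' ht ht' hzd htd hk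
  · rw [dist_comm]
    exact key z' hz' z hz t' t d ht0' ht0 ht' ht (by rwa [dist_comm]) (by rwa [abs_sub_comm]) hk

/-- Properness of the homotopy: a bound on the height of its values bounds the dilation factor and
the level `y` at which `F` is evaluated, and `√(L h)` is at most `dilation * y`. -/
theorem exists_height_le_of_radialHomotopy_le {F : E × ℝ → E' × ℝ} {X : Set E} (hL : 1 ≤ L)
    (hpos : ∀ z ∈ coneAbove L X, 1 ≤ (F z).2)
    (hF : ∀ b : ℝ, ∃ m : ℝ, ∀ z ∈ coneAbove L X, (F z).2 ≤ b → z.2 ≤ m) (b : ℝ) :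
    ∃ m : ℝ, ∀ z ∈ coneAbove L X, ∀ t : ℝ, t ≤ 2 * z.2 →
      (radialHomotopy F L z t).2 ≤ b → z.2 ≤ m := by
  obtain ⟨m, hm⟩ := hF b
  refine ⟨(b * m) * (b * m), fun z hz t ht hb => ?_⟩
  have hL0 : 0 < L := by linarith
  have hh : 0 < z.2 := hL0.trans_le hz.2
  have hk := one_le_dilation hL0 hz.2 (t := t)
  have hy := le_descent_div_dilation hL0 hz.2 ht
  have hs : √(L * z.2) ≤ descent L z.2 t := le_max_right _ _
  have hsq := sq_sqrt_mul hL0 hz.2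
  have hs0 := sqrt_mul_pos hL0 hz.2
  have hsnd : ((descent L z.2 t / dilation L z.2 t / z.2) • z).2 =
      descent L z.2 t / dilation L z.2 t := by
    rw [Prod.smul_snd, smul_eq_mul, div_mul_cancel₀ _ hh.ne']
  have hmem : (descent L z.2 t / dilation L z.2 t / z.2) • z ∈ coneAbove L X :=
    ⟨smul_mem_cone hz.1 (div_nonneg (hL0.le.trans hy) hh.le), by rw [hsnd]; exact hy⟩
  have h1 := hpos _ hmem
  rw [radialHomotopy, Prod.smul_snd, smul_eq_mul] at hb
  have h2 : (F ((descent L z.2 t / dilation L z.2 t / z.2) • z)).2 ≤ b := by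
    nlinarith [mul_self_nonneg (dilation L z.2 t - 1)]
  have h3 : dilation L z.2 t ≤ b := by nlinarith
  have h4 := hm _ hmem h2
  rw [hsnd, div_le_iff₀ (by linarith)] at h4
  have hm0 : 0 < m := by
    have := hs0.trans_le (hs.trans h4)
    exact (pos_iff_pos_of_mul_pos this).2 (by linarith)
  have h5 : √(L * z.2) ≤ b * m := by
    calc √(L * z.2) ≤ m * dilation L z.2 t := hs.trans h4
      _ ≤ m * b := by gcongr
      _ = b * m := mul_comm _ _
  calc z.2 ≤ L * z.2 := le_mul_of_one_le_left hh.le hL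
    _ = √(L * z.2) * √(L * z.2) := hsq.symm
    _ ≤ (b * m) * (b * m) := mul_self_le_mul_self hs0.le h5

end RadialHomotopy

/-! ### Coarse homotopies to radial maps -/

section CoarseHomotopy

theorem isCoarse_of_dist_le {T B : Type*} [PseudoMetricSpace T] [PseudoMetricSpace B] {f : T → B}
    {c : ℝ} (hc : 0 ≤ c) (hf : ∀ x y, dist (f x) (f y) ≤ c * dist x y + c) {μ : B → ℝ}
    (hμ : ∀ x y, μ x - μ y ≤ dist x y)
    (hprop : ∀ b : ℝ, Bornology.IsBounded {x | μ (f x) ≤ b}) : IsCoarse f := by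
  refine ⟨fun R hR => ⟨c * R + c + 1, by positivity, fun x y hxy => ?_⟩, fun D hD => ?_⟩
  · have := hf x y
    have : c * dist x y ≤ c * R := by gcongr
    linarith
  · obtain ⟨b, hb⟩ := Metric.isBounded_iff.1 hD
    rcases D.eq_empty_or_nonempty with rfl | ⟨y, hy⟩
    · simp
    · refine (hprop (μ y + b)).subset fun x hx => ?_
      have h1 := hμ (f x) y
      have h2 := hb hx hy
      change μ (f x) ≤ μ y + b
      linarith

theorem isBounded_of_norm_le {T W : Type*} [PseudoMetricSpace T] [NormedAddCommGroup W] (π : T → W)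
    (τ : T → ℝ≥0) (h : ∀ x y, dist x y ≤ max (dist (π x) (π y)) (dist (τ x) (τ y))) {s : Set T}
    {m : ℝ} (hs : ∀ x ∈ s, ‖π x‖ ≤ m ∧ (τ x : ℝ) ≤ m) : Bornology.IsBounded s := by
  refine Metric.isBounded_iff.2 ⟨2 * m, fun x hx y hy => (h x y).trans (max_le ?_ ?_)⟩
  · have := dist_le_norm_add_norm (π x) (π y)
    have := hs x hx
    have := hs y hy
    linarith
  · have h1 := hs x hx
    have h2 := hs y hy
    have h3 := (τ x).coe_nonneg
    have h4 := (τ y).coe_nonneg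
    rw [NNReal.dist_eq, abs_le]
    constructor <;> linarith

theorem isProperMap_of_isBounded_preimage {T B : Type*} [PseudoMetricSpace T] [ProperSpace T]
    [MetricSpace B] {g : T → B} (hg : Continuous g)
    (h : ∀ D : Set B, Bornology.IsBounded D → Bornology.IsBounded (g ⁻¹' D)) : IsProperMap g :=
  isProperMap_iff_isCompact_preimage.2 ⟨hg, fun _ hK =>
    Metric.isCompact_of_isClosed_isBounded (hK.isClosed.preimage hg) (h _ hK.isBounded)⟩

theorem LipschitzOnWith.exists_norm_le_mul_snd {E F : Type*} [NormedAddCommGroup E]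
    [NormedAddCommGroup F] {A : Set (E × ℝ)} {G : E × ℝ → F} {C : ℝ≥0}
    (hG : LipschitzOnWith C G A) {R : ℝ} (hR0 : 0 ≤ R) (hR : ∀ z ∈ A, ‖z‖ ≤ R * z.2)
    (h1 : ∀ z ∈ A, 1 ≤ z.2) : ∃ c : ℝ, 0 ≤ c ∧ ∀ z ∈ A, ‖G z‖ ≤ c * z.2 := by
  rcases A.eq_empty_or_nonempty with rfl | ⟨z₀, hz₀⟩
  · exact ⟨0, le_rfl, fun z hz => hz.elim⟩
  · refine ⟨‖G z₀‖ + C * ‖z₀‖ + C * R, by positivity, fun z hz => ?_⟩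
    have h2 : ‖G z - G z₀‖ ≤ C * ‖z - z₀‖ := by
      rw [← dist_eq_norm, ← dist_eq_norm]; exact hG.dist_le_mul z hz z₀ hz₀
    have h3 := h1 z hz
    calc ‖G z‖ = ‖G z₀ + (G z - G z₀)‖ := by rw [add_sub_cancel]
      _ ≤ ‖G z₀‖ + C * (R * z.2 + ‖z₀‖) := by
        refine (norm_add_le _ _).trans (add_le_add le_rfl (h2.trans ?_))
        gcongr
        exact (_root_.norm_sub_le _ _).trans (add_le_add (hR z hz) le_rfl)
      _ = (‖G z₀‖ + C * ‖z₀‖) * 1 + C * R * z.2 := by ring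
      _ ≤ (‖G z₀‖ + C * ‖z₀‖) * z.2 + C * R * z.2 := by gcongr
      _ = _ := by ring

variable {E E' : Type*} [NormedAddCommGroup E] [NormedSpace ℝ E] [FiniteDimensional ℝ E]
  [NormedAddCommGroup E'] [NormedSpace ℝ E']

/-- If, from level `L` on, a coarse map of pairs of cones is close to a Lipschitz map `G` of pairs,
relative to a subcone on which it is radial, then it is coarsely homotopic to the radial extension
of the restriction of `G` to level `L`. The homotopy jumps from `f` to `G` at time `0` and then
follows `radialHomotopy`. -/
theorem IsCoarsePairMap.exists_homotopy_radial {X X₀ X₁ : Set E} {Y Y₀ : Set E'}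
    (hXcl : IsClosed (cone X)) {R : ℝ} (hR1 : 1 ≤ R)
    (hR : ∀ z ∈ cone X, ‖z‖ ≤ R * z.2) {f : cone X → cone Y}
    (hf : IsCoarsePairMap f (traceOn (cone X) (cone X₀)) (traceOn (cone Y) (cone Y₀)))
    (hrad : IsRadialOn f (cone X₁)) {L : ℝ} (hL1 : 1 ≤ L) (hL : 0 < L) {G : E × ℝ → E' × ℝ}
    {C : ℝ≥0} {D : ℝ} (hGC : LipschitzOnWith C G (coneAbove L X))
    (hGY : Set.MapsTo G (coneAbove L X) (cone Y))
    (hGY₀ : Set.MapsTo G (coneAbove L X₀) (cone Y₀))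
    (hGf : ∀ z : cone X, (z : E × ℝ) ∈ cone X₁ → L ≤ z.1.2 → G z = f z)
    (hGD : ∀ z : cone X, L ≤ z.1.2 → dist (G z) (f z) ≤ D)
    (hpos : ∀ z ∈ coneAbove L X, 1 ≤ (G z).2)
    (hprop : ∀ b : ℝ, ∃ m : ℝ, ∀ z ∈ coneAbove L X, (G z).2 ≤ b → z.2 ≤ m) :
    ∃ g : coneAbove L X → cone Y,
      IsRadialOn g Set.univ ∧
      ((∀ z ∈ coneAbove L X, z.2 = L → (G z).2 = L) → IsInducedOn g X Y) ∧ IsProperMap g ∧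
      (∃ C : ℝ≥0, LipschitzWith C g) ∧
      Set.EqOn g (restrictAbove L f) (traceOn (coneAbove L X) (cone X₁)) ∧
      ∃ (p : coneAbove L X → ℝ≥0) (H : Cyl p → cone Y),
        IsCoarsePairHomotopy p H (restrictAbove L f) g
          (traceOn (coneAbove L X) (cone X₀)) (traceOn (cone Y) (cone Y₀)) ∧
        ∃ (q : traceOn (coneAbove L X) (cone X₁) → ℝ≥0) (J : Cyl q → cone Y) (ρ : ℝ → ℝ → ℝ),
          (∀ a, (q a : ℝ) + 1 = (a.1.1.2 : ℝ)) ∧ IsCoarse q ∧ IsCoarse J ∧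
          (∀ (z : Cyl q) (x : X) (h : ℝ), (x : E) ∈ X₁ →
            (z.1.1.1.1 : E × ℝ) = (h • (x : E), h) →
            (J z : E' × ℝ) = ρ h (z.1.2 : ℝ) • (f (conePoint x L hL.le) : E' × ℝ)) ∧
          (∀ a : traceOn (coneAbove L X) (cone X₁), p a.1 = q a + q a + 1) ∧
          ∀ (a : traceOn (coneAbove L X) (cone X₁)) (t : ℝ≥0) (ht : (a.1, t) ∈ Cyl p)
            (ht' : (a, t) ∈ Cyl (fun b => q b + q b + 1)),
            H ⟨(a.1, t), ht⟩ = homotopyConcat J (homotopyInverse J) ⟨(a, t), ht'⟩ := by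
  classical
  have hR0 : 0 ≤ R := by linarith
  obtain ⟨c₀, hc₀, hgrowth⟩ := hGC.exists_norm_le_mul_snd hR0 (fun z hz => hR z hz.1)
    fun z hz => hL1.trans hz.2
  obtain ⟨c, hc, hΓd⟩ := exists_dist_radialHomotopy_le hL hGC hR0 hR hc₀ hgrowth
  have hΓprop := exists_height_le_of_radialHomotopy_le hL1 hpos hprop
  set Γ := radialHomotopy G L with hΓ
  have hΓY : ∀ (z : coneAbove L X) (t : ℝ), t ≤ 2 * z.1.2 → Γ z.1 t ∈ cone Y := fun z t ht =>
    radialHomotopy_mem hL hGY z.2 ht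
  -- common estimate for the boundedness of sets of bounded height
  have hbound : ∀ (z : coneAbove L X) (t : ℝ≥0) (m : ℝ), (t : ℝ) ≤ 2 * z.1.2 → z.1.2 ≤ m →
      ‖z.1‖ ≤ (R + 2) * m ∧ (t : ℝ) ≤ (R + 2) * m := by
    intro z t m ht hm
    have h1 := hR z.1 z.2.1
    have h2 : 0 < z.1.2 := hL.trans_le z.2.2
    have h3 : R * z.1.2 ≤ R * m := by gcongr
    have h4 : 0 ≤ R * m := mul_nonneg hR0 (by linarith)
    constructor <;> linarith
  have hμ : ∀ x y : cone Y, x.1.2 - y.1.2 ≤ dist x y := fun x y =>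
    (le_abs_self _).trans (le_max_right (dist x.1.1 y.1.1) (dist x.1.2 y.1.2))
  -- over a point of height `h`, the cylinder of `Q` has length `h`, and that of `p` length `2 h`
  let Q : coneAbove L X → ℝ≥0 := fun a => (a.1.2 - 1).toNNReal
  have hQ : ∀ a : coneAbove L X, (Q a : ℝ) + 1 = a.1.2 := fun a => by
    have := a.2.2
    simp only [Q]
    rw [Real.coe_toNNReal _ (by linarith)]; ring
  have hQd : ∀ a b : coneAbove L X, |(Q a : ℝ) - Q b| ≤ dist a b := fun a b => by
    have : (Q a : ℝ) - Q b = a.1.2 - b.1.2 := by rw [← hQ, ← hQ]; ring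
    rw [this]
    exact le_max_right (dist a.1.1 b.1.1) (dist a.1.2 b.1.2)
  let p : coneAbove L X → ℝ≥0 := fun a => Q a + Q a + 1
  have hp : ∀ a : coneAbove L X, (p a : ℝ) + 1 = 2 * a.1.2 := fun a => by
    rw [← hQ a]; simp only [p]; push_cast; ring
  have hcyl : ∀ z : Cyl p, (z.1.2 : ℝ) ≤ 2 * z.1.1.1.2 := fun z => by
    rw [← hp]; exact_mod_cast z.2
  have hdistΓ : ∀ (z z' : coneAbove L X) (t t' : ℝ≥0) (d : ℝ), (t : ℝ) ≤ 2 * z.1.2 →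
      (t' : ℝ) ≤ 2 * z'.1.2 → dist (z, t) (z', t') ≤ d → dist (Γ z.1 t) (Γ z'.1 t') ≤ c * d :=
    fun z z' t t' d ht ht' hd => hΓd z.1 z.2 z'.1 z'.2 t t' d t.2 t'.2 ht ht'
      ((le_max_left _ _).trans hd) ((le_max_right _ _).trans hd)
  -- `H` differs from the Lipschitz map `Γ'` only at time `0`, and there by a bounded amount
  let Γ' : Cyl p → cone Y := fun z => ⟨Γ z.1.1.1 z.1.2, hΓY z.1.1 z.1.2 (hcyl z)⟩
  let H : Cyl p → cone Y := fun z => if z.1.2 = 0 then restrictAbove L f z.1.1 else Γ' z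
  have hHΓ : ∀ z, dist (H z) (Γ' z) ≤ max D 0 := by
    intro z
    by_cases h0 : z.1.2 = 0
    · have h1 : H z = restrictAbove L f z.1.1 := if_pos h0
      have h2 : (Γ' z : E' × ℝ) = G z.1.1.1 := by
        change Γ z.1.1.1 z.1.2 = _
        rw [h0, NNReal.coe_zero, hΓ, radialHomotopy_zero G hL z.1.1.2.2]
      rw [h1, Subtype.dist_eq, h2, dist_comm]
      exact (hGD ⟨z.1.1.1, z.1.1.2.1⟩ z.1.1.2.2).trans (le_max_left _ _)
    · rw [show H z = Γ' z from if_neg h0, dist_self]; exact le_max_right _ _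
  let g : coneAbove L X → cone Y := fun z => ⟨Γ z.1 (2 * z.1.2), hΓY z _ le_rfl⟩
  have hg : ∀ z : coneAbove L X, (g z : E' × ℝ) = (z.1.2 / L) • G ((L / z.1.2) • z.1) := fun z =>
    radialHomotopy_two_mul G hL z.2.2
  have hh : ∀ z : coneAbove L X, 0 < z.1.2 := fun z => hL.trans_le z.2.2
  have hGrad : ∀ z ∈ coneAbove L X, z ∈ cone X₁ → ∀ r : ℝ, 0 ≤ r → L ≤ r * z.2 →
      G (r • z) = r • G z := by
    intro z hz hz₁ r hr hrz
    have h1 := hGf ⟨z, hz.1⟩ hz₁ hz.2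
    have h2 := hGf ⟨r • z, smul_mem_cone hz.1 hr⟩ (smul_mem_cone hz₁ hr) hrz
    rw [h1, h2]
    exact hrad _ _ hz₁ (smul_mem_cone hz₁ hr) r hr rfl
  have hglip : LipschitzWith (2 * c).toNNReal g := LipschitzWith.of_dist_le_mul fun a b => by
    rw [Real.coe_toNNReal _ (by positivity)]
    have h1 : |a.1.2 - b.1.2| ≤ dist a b := le_max_right (dist a.1.1 b.1.1) (dist a.1.2 b.1.2)
    have h0 : 0 ≤ dist a b := dist_nonneg
    have := hΓd a.1 a.2 b.1 b.2 (2 * a.1.2) (2 * b.1.2) (2 * dist a b)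
      (by linarith [hh a]) (by linarith [hh b]) le_rfl le_rfl
      (by rw [← Subtype.dist_eq]; linarith)
      (by rw [← mul_sub, abs_mul, abs_two]; linarith)
    rw [Subtype.dist_eq]
    exact this.trans_eq (by ring)
  have hgcoarse : IsCoarse g := by
    refine isCoarse_of_dist_le (c := 2 * c) (by positivity) (fun a b => ?_) hμ fun b => ?_
    · have h1 := hglip.dist_le_mul a b
      rw [Real.coe_toNNReal _ (by positivity)] at h1
      linarith
    · obtain ⟨m, hm⟩ := hΓprop b
      refine isBounded_of_norm_le (fun z => z.1) (fun _ => 0) (fun x y => le_max_left _ _)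
        (m := (R + 2) * m) fun z hz => hbound z 0 m ?_ (hm z.1 z.2 (2 * z.1.2) le_rfl hz)
      rw [NNReal.coe_zero]; linarith [hh z]
  refine ⟨g, ?_, fun hlev => ?_, ?_, ⟨_, hglip⟩, ?_, p, H, ⟨?_, ?_, ?_, ?_, ?_⟩, fun a => Q a.1,
    fun z => ⟨Γ z.1.1.1.1 z.1.2, hΓY z.1.1.1 z.1.2 ?_⟩,
    fun h t => max (h - t) √(L * h) / L, fun a => hQ a.1, ?_, ?_, ?_, fun a => rfl, ?_⟩
  · intro z w _ _ r hr hw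
    have hw2 : w.1.2 = r * z.1.2 := congrArg Prod.snd hw
    have hz := hh z
    have hr0 : r ≠ 0 := by
      rintro rfl
      have := hh w
      rw [hw2, zero_mul] at this
      exact lt_irrefl _ this
    rw [hg, hg, hw2, hw, smul_smul, smul_smul]
    congr 1
    · ring
    · congr 2; field_simp
  · have hbase : ∀ x : X, ∃ y : Y, G (L • (x : E), L) = (L • (y : E'), L) := by
      intro x
      have hx : ((L • (x : E), L) : E × ℝ) ∈ coneAbove L X := ⟨⟨x, x.2, L, hL.le, rfl⟩, le_rfl⟩
      obtain ⟨y, hy, h, -, hyh⟩ := hGY hx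
      have h1 := hlev _ hx rfl
      rw [hyh] at h1
      have h1 : h = L := h1
      exact ⟨⟨y, hy⟩, by rw [hyh, h1]⟩
    choose u hu using hbase
    refine ⟨u, fun z x h h0 hz => ?_⟩
    have hz2 : z.1.2 = h := congrArg Prod.snd hz
    have hhp : 0 < h := hz2 ▸ hh z
    have h1 : (L / h) • ((h • (x : E), h) : E × ℝ) = (L • (x : E), L) := by
      rw [Prod.smul_mk, smul_smul, smul_eq_mul, div_mul_cancel₀ _ hhp.ne']
    rw [hg, hz2, hz, h1, hu, Prod.smul_mk, smul_smul, smul_eq_mul, div_mul_cancel₀ _ hL.ne']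
  · have hcl : IsClosed (coneAbove L X) :=
      hXcl.inter (isClosed_le continuous_const continuous_snd)
    have : ProperSpace (coneAbove L X) := .of_isClosed hcl
    exact isProperMap_of_isBounded_preimage hglip.continuous hgcoarse.2
  · intro z hz
    have h1 := hGf ⟨z.1, z.2.1⟩ hz z.2.2
    refine Subtype.ext ?_
    rw [hg, hGrad z.1 z.2 hz _ (div_nonneg hL.le (hh z).le)
      (by rw [div_mul_cancel₀ _ (hh z).ne']), smul_smul,
      div_mul_div_cancel₀ hL.ne', div_self (hh z).ne', one_smul]
    exact h1
  · refine isCoarse_of_dist_le (c := 2) two_pos.le (fun a b => ?_)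
      (μ := fun x : ℝ≥0 => (x : ℝ)) (fun x y => le_abs_self _) fun b => ?_
    · have h1 := hQd a b
      have h0 : 0 ≤ dist a b := dist_nonneg
      have h2 : (p a : ℝ) - p b = 2 * ((Q a : ℝ) - Q b) := by simp only [p]; push_cast; ring
      rw [NNReal.dist_eq, h2, abs_mul, abs_two]
      linarith
    · refine isBounded_of_norm_le (fun z => z.1) (fun _ => 0) (fun x y => le_max_left _ _)
        (m := (R + 2) * (b + 1)) fun z hz => hbound z 0 (b + 1) ?_ ?_
      · rw [NNReal.coe_zero]; linarith [hh z]
      · have h1 := hp z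
        have h2 : (p z : ℝ) ≤ b := hz
        linarith [hh z]
  · refine isCoarse_of_dist_le (c := c + 2 * max D 0)
      (add_nonneg hc (mul_nonneg two_pos.le (le_max_right _ _))) (fun a b => ?_) hμ fun b => ?_
    · have h1 := hHΓ a
      have h2 := hHΓ b
      rw [dist_comm] at h2
      have h3 : dist (Γ' a) (Γ' b) ≤ c * dist a b :=
        hdistΓ a.1.1 b.1.1 a.1.2 b.1.2 _ (hcyl a) (hcyl b) le_rfl
      have h4 := dist_triangle4 (H a) (Γ' a) (Γ' b) (H b)
      have h5 : 0 ≤ max D 0 * dist a b := mul_nonneg (le_max_right _ _) dist_nonneg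
      linarith
    · obtain ⟨m, hm⟩ := hΓprop (b + max D 0)
      refine isBounded_of_norm_le (fun z => z.1.1.1) (fun z => z.1.2) (fun x y => le_rfl)
        (m := (R + 2) * m) fun z hz => hbound z.1.1 z.1.2 m (hcyl z)
          (hm _ z.1.1.2 z.1.2 (hcyl z) ?_)
      have h1 := hμ (Γ' z) (H z)
      have h2 := hHΓ z
      rw [dist_comm] at h2
      have h3 : (H z).1.2 ≤ b := hz
      change (Γ' z).1.2 ≤ _
      linarith
  · exact fun a => if_pos rfl
  · intro a
    refine (if_neg (show p a + 1 ≠ 0 by positivity)).trans (Subtype.ext ?_)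
    change Γ a.1 ((p a + 1 : ℝ≥0) : ℝ) = Γ a.1 (2 * a.1.2)
    rw [← hp a]; push_cast; rfl
  · intro z hz
    by_cases h0 : z.1.2 = 0
    · rw [show H z = restrictAbove L f z.1.1 from if_pos h0]
      exact hf.2 (show (⟨z.1.1.1, z.1.1.2.1⟩ : cone X) ∈ traceOn (cone X) (cone X₀) from hz)
    · rw [show H z = Γ' z from if_neg h0]
      exact radialHomotopy_mem hL hGY₀ ⟨hz, z.1.1.2.2⟩ (hcyl z)
  · have h1 : (z.1.2 : ℝ) ≤ Q z.1.1.1 + 1 := by exact_mod_cast z.2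
    rw [hQ] at h1
    linarith [hh z.1.1.1]
  · refine isCoarse_of_dist_le (c := 1) zero_le_one (fun a b => ?_)
      (μ := fun x : ℝ≥0 => (x : ℝ)) (fun x y => le_abs_self _) fun b => ?_
    · have h1 : dist (Q a.1) (Q b.1) ≤ dist a b := hQd a.1 b.1
      linarith
    · refine isBounded_of_norm_le (fun z => z.1.1) (fun _ => 0) (fun x y => le_max_left _ _)
        (m := (R + 2) * (b + 1)) fun z hz => hbound z.1 0 (b + 1) ?_ ?_
      · rw [NNReal.coe_zero]; linarith [hh z.1]
      · have h1 := hQ z.1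
        have h2 : (Q z.1 : ℝ) ≤ b := hz
        linarith
  · have hcyl' : ∀ z : Cyl (fun a : traceOn (coneAbove L X) (cone X₁) => Q a.1),
        (z.1.2 : ℝ) ≤ 2 * z.1.1.1.1.2 := fun z => by
      have h1 : (z.1.2 : ℝ) ≤ Q z.1.1.1 + 1 := by exact_mod_cast z.2
      rw [hQ] at h1
      linarith [hh z.1.1.1]
    refine isCoarse_of_dist_le hc (fun a b => ?_) hμ fun b => ?_
    · have := hdistΓ a.1.1.1 b.1.1.1 a.1.2 b.1.2 (dist a b) (hcyl' a) (hcyl' b) le_rfl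
      exact this.trans (by linarith)
    · obtain ⟨m, hm⟩ := hΓprop b
      exact isBounded_of_norm_le (fun z => z.1.1.1.1) (fun z => z.1.2) (fun x y => le_rfl)
        (m := (R + 2) * m) fun z hz => hbound z.1.1.1 z.1.2 m (hcyl' z)
          (hm _ z.1.1.1.2 z.1.2 (hcyl' z) hz)
  · intro z x h hx hz
    have hz2 : z.1.1.1.1.2 = h := congrArg Prod.snd hz
    have hhp : 0 < h := hz2 ▸ hh z.1.1.1
    have hth : (z.1.2 : ℝ) ≤ h := by
      have h1 : (z.1.2 : ℝ) ≤ Q z.1.1.1 + 1 := by exact_mod_cast z.2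
      rwa [hQ, hz2] at h1
    have hLh : L ≤ h := hz2 ▸ z.1.1.1.2.2
    have hσ := sqrt_mul_pos hL hLh
    have h1 : (f ⟨z.1.1.1.1, z.1.1.1.2.1⟩ : E' × ℝ) =
        (h / L) • (f (conePoint x L hL.le) : E' × ℝ) := by
      refine hrad (conePoint x L hL.le) ⟨z.1.1.1.1, z.1.1.1.2.1⟩ ⟨x, hx, L, hL.le, rfl⟩ z.1.1.2
        (h / L) (div_nonneg hhp.le hL.le) ?_
      change z.1.1.1.1 = (h / L) • ((L • (x : E), L) : E × ℝ)
      rw [hz, Prod.smul_mk, smul_smul, smul_eq_mul, div_mul_cancel₀ _ hL.ne']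
    change Γ z.1.1.1.1 z.1.2 = _
    rw [hΓ, radialHomotopy_of_radial hL z.1.1.1.2.2 (by rw [hz2]; linarith)
      (hGrad _ z.1.1.1.2 z.1.1.2), hGf ⟨z.1.1.1.1, z.1.1.1.2.1⟩ z.1.1.2 z.1.1.1.2.2, h1, smul_smul,
      hz2, max_eq_right (a := (z.1.2 : ℝ) - h) (by linarith)]
    congr 1
    field_simp
  · intro a t ht ht'
    have hHt : H ⟨(a.1, t), ht⟩ = Γ' ⟨(a.1, t), ht⟩ := by
      by_cases h0 : t = 0
      · have e : H ⟨(a.1, t), ht⟩ = restrictAbove L f a.1 := if_pos h0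
        rw [e]
        refine Subtype.ext ?_
        change (f ⟨a.1.1, a.1.2.1⟩ : E' × ℝ) = Γ a.1.1 t
        rw [h0, NNReal.coe_zero, hΓ, radialHomotopy_zero G hL a.1.2.2,
          hGf ⟨a.1.1, a.1.2.1⟩ a.2 a.1.2.2]
      · exact if_neg h0
    have ht2 : (t : ℝ) ≤ 2 * a.1.1.2 := hcyl ⟨(a.1, t), ht⟩
    rw [hHt]
    refine Subtype.ext ?_
    change Γ a.1.1 t = _
    by_cases hta : t ≤ Q a.1 + 1
    · rw [homotopyConcat, dif_pos hta]
    · rw [homotopyConcat, dif_neg hta, homotopyInverse]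
      dsimp only
      have hta' : a.1.1.2 < t := by
        rw [← hQ a.1]; exact_mod_cast not_le.1 hta
      -- inversion and concatenation amount to the substitution `t ↦ 2 h - t`, which exchanges the
      -- two maxima in the formula for `Γ` where `G` is radial
      have hs : ((Q a.1 + 1 - (t - (Q a.1 + 1)) : ℝ≥0) : ℝ) = 2 * a.1.1.2 - t := by
        have e1 : ((t - (Q a.1 + 1) : ℝ≥0) : ℝ) = t - a.1.1.2 := by
          rw [NNReal.coe_sub (not_le.1 hta).le]; push_cast; rw [hQ]
        rw [NNReal.coe_sub, e1]
        · push_cast; rw [hQ]; ring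
        · rw [← NNReal.coe_le_coe, e1]; push_cast; rw [hQ]; linarith
      rw [hs, hΓ, radialHomotopy_of_radial hL a.1.2.2 ht2 (hGrad _ a.1.2 a.2),
        radialHomotopy_of_radial hL a.1.2.2 (by linarith [hh a.1, t.coe_nonneg])
          (hGrad _ a.1.2 a.2)]
      congr 2
      rw [mul_comm]
      congr 2 <;> ring

end CoarseHomotopy

/-! ### Coarse maps of pairs of cones -/

/-- A map at bounded distance from a coarse map into a cone with bounded base is proper with
respect to heights. -/
theorem IsCoarse.exists_height_le {E E' : Type*} [NormedAddCommGroup E] [NormedSpace ℝ E]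
    [NormedAddCommGroup E'] [NormedSpace ℝ E'] {X : Set E} {Y : Set E'}
    {f : cone X → cone Y} (hf : IsCoarse f)
    {F : E × ℝ → E' × ℝ} (hFY : Set.MapsTo F (cone X) (cone Y)) {R D : ℝ} (hR0 : 0 ≤ R)
    (hR : ∀ z ∈ cone Y, ‖z‖ ≤ R * z.2) (hD : ∀ z : cone X, dist (F z) (f z) ≤ D) (b : ℝ) :
    ∃ m : ℝ, ∀ z ∈ cone X, (F z).2 ≤ b → z.2 ≤ m := by
  have hbd : Bornology.IsBounded {y : cone Y | ‖(y : E' × ℝ)‖ ≤ R * b + D} :=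
    isBounded_of_norm_le (fun y => y.1) (fun _ => 0) (fun x y => le_max_left _ _)
      (m := max (R * b + D) 0) fun y hy => ⟨le_max_of_le_left hy, le_max_right _ _⟩
  obtain ⟨c, hc⟩ := Metric.isBounded_iff.1 (hf.2 _ hbd)
  rcases {z : cone X | (F z).2 ≤ b}.eq_empty_or_nonempty with he | ⟨z₀, hz₀⟩
  · refine ⟨0, fun z hz hb => ?_⟩
    have : (⟨z, hz⟩ : cone X) ∈ {z : cone X | (F z).2 ≤ b} := hb
    rw [he] at this
    exact this.elim
  · have hmem : ∀ z : cone X, (F z).2 ≤ b →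
        z ∈ f ⁻¹' {y : cone Y | ‖(y : E' × ℝ)‖ ≤ R * b + D} := by
      intro z hz
      have h1 := hR _ (hFY z.2)
      have h2 : R * (F z).2 ≤ R * b := by gcongr
      have h3 := hD z
      rw [dist_comm, dist_eq_norm] at h3
      have h4 := norm_add_le (F z) (f z - F z)
      rw [add_sub_cancel] at h4
      change ‖(f z : E' × ℝ)‖ ≤ R * b + D
      linarith
    refine ⟨z₀.1.2 + c, fun z hz hb => ?_⟩
    have h1 := hc (hmem ⟨z, hz⟩ hb) (hmem z₀ hz₀)
    have h2 : |z.2 - z₀.1.2| ≤ c := (le_max_right _ _).trans h1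
    have h3 := le_abs_self (z.2 - z₀.1.2)
    linarith

theorem mainTheorem4 {n k l : ℕ}
    -- finite simplicial complexes with subcomplexes, realized in some Euclidean spaces
    (K K₀ : Geometry.SimplicialComplex ℝ (EuclideanSpace ℝ (Fin k)))
    (M M₀ : Geometry.SimplicialComplex ℝ (EuclideanSpace ℝ (Fin l)))
    (hK : K.faces.Finite) (hM : M.faces.Finite) (hK₀ : K₀ ≤ K) (hM₀ : M₀ ≤ M)
    -- PL-embeddings into `ℝⁿ`, and the embedded complexes
    (i : EuclideanSpace ℝ (Fin k) → EuclideanSpace ℝ (Fin n))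
    (j : EuclideanSpace ℝ (Fin l) → EuclideanSpace ℝ (Fin n))
    (hi : IsPLEmbedding K i) (hj : IsPLEmbedding M j)
    (X X₀ Y Y₀ : Set (EuclideanSpace ℝ (Fin n)))
    (hX : X = i '' K.space) (hX₀ : X₀ = i '' K₀.space)
    (hY : Y = j '' M.space) (hY₀ : Y₀ = j '' M₀.space)
    -- a coarse map of pairs
    (f : cone X → cone Y)
    (hf : IsCoarsePairMap f (traceOn (cone X) (cone X₀)) (traceOn (cone Y) (cone Y₀))) :
    (∃ L : ℝ, 0 < L ∧ ∃ g : coneAbove L X → cone Y,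
      IsRadialOn g Set.univ ∧ IsInducedOn g X Y ∧ IsProperMap g ∧
      (∃ C : ℝ≥0, LipschitzWith C g) ∧
      CoarselyHomotopicPair (restrictAbove L f) g
        (traceOn (coneAbove L X) (cone X₀)) (traceOn (cone Y) (cone Y₀))) ∧
    (∀ (K₁ : Geometry.SimplicialComplex ℝ (EuclideanSpace ℝ (Fin k))), K₁ ≤ K →
      ∀ X₁ : Set (EuclideanSpace ℝ (Fin n)), X₁ = i '' K₁.space →
      -- `f` is radial and Lipschitz on `c(X₁)`
      IsRadialOn f (cone X₁) →
      (∃ C : ℝ≥0, LipschitzOnWith C f (traceOn (cone X) (cone X₁))) →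
      ∃ (L : ℝ) (hL : 0 < L) (g : coneAbove L X → cone Y),
        IsRadialOn g Set.univ ∧ (IsInducedOn f X₁ Y → IsInducedOn g X Y) ∧ IsProperMap g ∧
        (∃ C : ℝ≥0, LipschitzWith C g) ∧
        -- `g` and `f` agree on `c_L(X₁)`
        Set.EqOn g (restrictAbove L f) (traceOn (coneAbove L X) (cone X₁)) ∧
        ∃ (p : coneAbove L X → ℝ≥0) (H : Cyl p → cone Y),
          IsCoarsePairHomotopy p H (restrictAbove L f) g
            (traceOn (coneAbove L X) (cone X₀)) (traceOn (cone Y) (cone Y₀)) ∧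
          -- a coarse homotopy `J` on `c_L(X₁)`, with time parameter `0 ≤ t ≤ h` over `(h x, h)`,
          -- of the form `J (h x, h, t) = ρ (h, t) f (L x, L)`
          ∃ (q : traceOn (coneAbove L X) (cone X₁) → ℝ≥0) (J : Cyl q → cone Y) (ρ : ℝ → ℝ → ℝ),
            (∀ a, (q a : ℝ) + 1 = (a.1.1.2 : ℝ)) ∧ IsCoarse q ∧ IsCoarse J ∧
            (∀ (z : Cyl q) (x : X) (h : ℝ), (x : EuclideanSpace ℝ (Fin n)) ∈ X₁ →
              (z.1.1.1.1 : EuclideanSpace ℝ (Fin n) × ℝ) = (h • (x : EuclideanSpace ℝ (Fin n)), h) →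
              (J z : EuclideanSpace ℝ (Fin n) × ℝ) =
                ρ h (z.1.2 : ℝ) • (f (conePoint x L hL.le) : EuclideanSpace ℝ (Fin n) × ℝ)) ∧
            -- over `c_L(X₁)`, `H` is the concatenation of `J` with its inverse
            (∀ a : traceOn (coneAbove L X) (cone X₁), p a.1 = q a + q a + 1) ∧
            ∀ (a : traceOn (coneAbove L X) (cone X₁)) (t : ℝ≥0) (ht : (a.1, t) ∈ Cyl p)
              (ht' : (a, t) ∈ Cyl (fun b => q b + q b + 1)),
              H ⟨(a.1, t), ht⟩ = homotopyConcat J (homotopyInverse J) ⟨(a, t), ht'⟩) := by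
  -- the second part carries the whole content: the first one is the case `X₁ = ∅`
  refine (and_iff_right_of_imp fun part2 => ?_).2 ?_
  -- the first part is the case `X₁ = ∅` of the second one
  · have hcone : cone (∅ : Set (EuclideanSpace ℝ (Fin n))) = ∅ :=
      Set.eq_empty_of_forall_notMem fun z ⟨x, hx, _⟩ => hx
    obtain ⟨L, hL, g, hrad, hind, hprop, hlip, -, p, H, hH, -⟩ := part2 ⊥ bot_le ∅
      (by rw [Geometry.SimplicialComplex.space_bot, Set.image_empty])
      (fun z w hz => by rw [hcone] at hz; exact hz.elim)
      ⟨0, fun z hz => by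
        have hz : (z : EuclideanSpace ℝ (Fin n) × ℝ) ∈ cone ∅ := hz
        rw [hcone] at hz; exact hz.elim⟩
    exact ⟨L, hL, g, hrad, hind ⟨fun x => x.2.elim, fun z x => x.2.elim⟩, hprop, hlip, p, H, hH⟩
  · intro K₁ hK₁ X₁ hX₁ hrad ⟨C, hC⟩
    obtain ⟨F, CF, D, hF, hFY, hFY₀, hFf, hFD⟩ :=
      hf.exists_lipschitz_approximation hi hj hK₀ hK₁ hM₀ hX hX₀ hX₁ hY hY₀ hC
    have hX₀X : X₀ ⊆ X := by
      rw [hX, hX₀]; exact Set.image_mono (Set.biUnion_subset_biUnion_left hK₀)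
    have hXcl : IsClosed (cone X) := hX ▸ hi.isClosed_cone
    obtain ⟨R, hR1, hR⟩ := hi.exists_norm_le_mul_snd
    obtain ⟨R', hR1', hR'⟩ := hj.exists_norm_le_mul_snd
    rw [← hX] at hR
    rw [← hY] at hR'
    have hprop := hf.1.exists_height_le hFY (by linarith) hR' hFD
    obtain ⟨m, hm⟩ := hprop 1
    -- above level `L`, the values of `F` have height at least `1`
    set L := max 1 (m + 1)
    have hL1 : 1 ≤ L := le_max_left _ _
    have hL : 0 < L := by linarith
    have hpos : ∀ z ∈ cone X, L ≤ z.2 → 1 ≤ (F z).2 := by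
      intro z hz hzL
      by_contra! h
      have h1 := hm z hz h.le
      have h2 : m + 1 ≤ L := le_max_right _ _
      linarith
    by_cases hind : IsInducedOn f X₁ Y
    -- if `f` is induced on `X₁`, then `F` preserves heights there, so that the normalization of
    -- heights at level `L` does not change it on the cone over `X₁`
    · obtain ⟨c₀, hc₀, hgrowth⟩ := LipschitzOnWith.exists_norm_le_mul_snd
        (hF.mono fun z (hz : z ∈ coneAbove L X) => hz.1) (by linarith)
        (fun z hz => hR z hz.1) fun z hz => hL1.trans hz.2
      obtain ⟨κ, C', D', hκ, hκ'⟩ := exists_height_normalization hL hc₀ hF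
        (fun z hz => hR' _ (hFY hz)) hpos
        (fun z hz hzL => (Real.le_norm_self _).trans ((norm_snd_le _).trans (hgrowth z ⟨hz, hzL⟩)))
      obtain ⟨g, h1, h2, h3⟩ := hf.exists_homotopy_radial (X₁ := X₁) (G := fun z => κ z • F z)
        (D := D' + D) hXcl hR1 hR hrad hL1 hL hκ
        (fun z hz => smul_mem_cone (hFY hz.1) (hκ' z hz.1 hz.2).1.le)
        (fun z hz => smul_mem_cone (hFY₀ hz.1) (hκ' z (cone_mono hX₀X hz.1) hz.2).1.le)
        (fun z hz hzL => by
          obtain ⟨u, hu⟩ := hind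
          obtain ⟨x, hx, h, hh, hzx⟩ := hz
          have h1 := hu z ⟨x, hx⟩ h hh hzx
          have h2 : (F z).2 = z.1.2 := by
            rw [hFf z ⟨x, hx, h, hh, hzx⟩, h1, hzx]
          have h3 : κ z = 1 := (hκ' z z.2 hzL).2.2.1 h2
          rw [h3, one_smul, hFf z ⟨x, hx, h, hh, hzx⟩])
        (fun z hzL => (dist_triangle _ (F z) _).trans
          (add_le_add (hκ' z z.2 hzL).2.1 (hFD z)))
        (fun z hz => (le_min (hpos z hz.1 hz.2) (hL1.trans hz.2)).trans
          (hκ' z hz.1 hz.2).2.2.2.2)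
        (fun b => by
          obtain ⟨m, hm⟩ := hprop b
          refine ⟨max m b, fun z hz hzb => ?_⟩
          rcases min_le_iff.1 ((hκ' z hz.1 hz.2).2.2.2.2.trans hzb) with h | h
          · exact (hm z hz.1 h).trans (le_max_left _ _)
          · exact h.trans (le_max_right _ _))
      exact ⟨L, hL, g, h1, fun _ => h2 fun z hz hzL => (hκ' z hz.1 hz.2).2.2.2.1 hzL, h3⟩
    · obtain ⟨g, h1, -, h3⟩ := hf.exists_homotopy_radial (X₁ := X₁) (G := F) hXcl hR1 hR hrad
        hL1 hL (hF.mono fun z hz => hz.1) (fun z hz => hFY hz.1) (fun z hz => hFY₀ hz.1)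
        (fun z hz _ => hFf z hz) (fun z _ => hFD z) (fun z hz => hpos z hz.1 hz.2)
        (fun b => (hprop b).imp fun m hm z hz => hm z hz.1)
      exact ⟨L, hL, g, h1, fun h => absurd h hind, h3⟩
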